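/- A Bravais lattice is a set $L=\mathbb{Z}u_0\oplus\mathbb{Z}u_1\subset\mathbb{R}^2$ with $u_0,u_1$ linearly independent; its density is the inverse of the area of a unit cell. Let $\Lambda=\sqrt{2/\sqrt3}\,\big[\mathbb{Z}(1,0)\oplus\mathbb{Z}(\tfrac12,\tfrac{\sqrt3}{2})\big]$ be the triangular lattice of unit density. For a nonnegative function $f$ on $\mathbb{R}^2$ and a probability measure $\mu$ on $\mathbb{R}^2$ put $$\mathcal{E}_{f,\mu}[L]=\sum_{x\in L\setminus\{0\}}\iint_{\mathbb{R}^2\times\mathbb{R}^2}f(u-x-v)\,d\mu(u)\,d\mu(v)\in[0,\infty].$$ Let $f:\mathbb{R}^2\to\mathbb{R}$ be not identically zero and such that: (i) there are $C,\eta>0$ with $|f(x)|+|\hat f(x)|\le C(1+|x|)^{-2-\eta}$ for all $x\in\mathbb{R}^2$, where $\hat f(p)=\int_{\mathbb{R}^2} f(x)e^{-2\pi i p\cdot x}\,dx$; (ii) there is a nonnegative Radon measure $\mu_f$ on $[0,\infty)$ with $f(x)=\int_0^\infty e^{-|x|^2t}\,d\mu_f(t)$ for all $x\in\mathbb{R}^2$.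 Let $\mu$ be a probability measure on $\mathbb{R}^2$ with a density $\rho:\mathbb{R}^2\to\mathbb{R}$ such that $\rho(x)=\int_0^\infty e^{-|x|^2t}\,d\mu_\rho(t)$ for all $x\in\mathbb{R}^2$, for some nonnegative Radon measure $\mu_\rho$ on $[0,\infty)$. Then for every $\delta>0$ the triangular lattice $\delta^{-1/2}\Lambda$ of density $\delta$ is the unique minimizer, up to rotation about the origin, of $\mathcal{E}_{f,\mu}$ among all Bravais lattices of density $\delta$: every Bravais lattice $L$ of density $\delta$ satisfies $\mathcal{E}_{f,\mu}[L]\ge\mathcal{E}_{f,\mu}[\delta^{-1/2}\Lambda]$, with equality if and only if $L$ is a rotated copy of $\delta^{-1/2}\Lambda$. In particular ($\delta=1$), $\Lambda$ is the unique minimizer, up to rotation, among all Bravais lattices of unit density. -/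

import Mathlib

open MeasureTheory Set
open scoped FourierTransform ENNReal Pointwise

/-- The Euclidean plane. -/
abbrev Plane : Type := EuclideanSpace ℝ (Fin 2)

/-- `g` is the transform `g(x) = ∫_0^∞ e^{-|x|² t} dm(t)`, at every point `x` of the plane (so also
at the origin), of a nonnegative Radon measure `m` on the half-line. A locally finite Borel measure
on the real line is Radon; only its restriction to the half-line `[0, ∞)` matters here. -/
def IsLaplaceOfSquaredNorm (g : Plane → ℝ) : Prop :=
  ∃ m : Measure ℝ, IsLocallyFiniteMeasure m ∧
    ∀ x : Plane, IntegrableOn (fun t : ℝ => Real.exp (-‖x‖ ^ 2 * t)) (Ici 0) m ∧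
      g x = ∫ t in Ici (0 : ℝ), Real.exp (-‖x‖ ^ 2 * t) ∂m

/-- The class of interaction potentials: `f` and its Fourier transform (normalised as
`f̂(p) = ∫ f(x) e^{-2πi p·x} dx`) decay faster than `|x|^{-2}`, and `f` is the transform of a
nonnegative Radon measure as above. -/
structure IsPotential (f : Plane → ℝ) : Prop where
  decay : ∃ C > (0 : ℝ), ∃ η > (0 : ℝ), ∀ x : Plane,
    |f x| + ‖𝓕 (fun y : Plane => (f y : ℂ)) x‖ ≤ C / (1 + ‖x‖) ^ (2 + η)
  laplace : IsLaplaceOfSquaredNorm f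

/-- A Bravais lattice `ℤ u₀ ⊕ ℤ u₁` with `u₀, u₁` linearly independent over the reals. -/
def IsBravaisLattice (L : Submodule ℤ Plane) : Prop :=
  ∃ u : Fin 2 → Plane, LinearIndependent ℝ u ∧ L = Submodule.span ℤ (range u)

/-- The density (number of points per unit area) of a lattice: the inverse of the area of a
fundamental domain. -/
noncomputable def latticeDensity (L : Submodule ℤ Plane) : ℝ := (ZLattice.covolume L)⁻¹

/-- The triangular lattice `√(2/√3) [ℤ(1,0) ⊕ ℤ(1/2,√3/2)]`, of unit density. -/
noncomputable def triangularLattice : Submodule ℤ Plane :=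
  Submodule.span ℤ (range ![√(2 / √3) • (!₂[1, 0] : Plane), √(2 / √3) • (!₂[1 / 2, √3 / 2] : Plane)])

/-- The energy per particle
`∑_{x ∈ L \ {0}} ∬ f(u - x - v) dμ(u) dμ(v)`, with values in `[0, ∞]`.
It is used for nonnegative potentials `f` only. -/
noncomputable def latticeEnergy (f : Plane → ℝ) (μ : Measure Plane) (L : Submodule ℤ Plane) : ℝ≥0∞ :=
  ∑' x : {x : Plane // x ∈ L ∧ x ≠ 0},
    ∫⁻ p : Plane × Plane, ENNReal.ofReal (f (p.1 - (x : Plane) - p.2)) ∂(μ.prod μ)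

/-- `L` is the image of `M` under a rotation about the origin. -/
def IsRotationOf (L M : Submodule ℤ Plane) : Prop :=
  ∃ R : Plane ≃ₗᵢ[ℝ] Plane, LinearMap.det (R.toLinearEquiv : Plane →ₗ[ℝ] Plane) = 1 ∧
    (L : Set Plane) = R '' (M : Set Plane)

/-- Among all Bravais lattices of density `δ`, the lattice `M` minimises `E`, and the minimisers are
exactly the rotated copies of `M`. -/
def IsUniqueMinimizerUpToRotation (E : Submodule ℤ Plane → ℝ≥0∞) (δ : ℝ)
    (M : Submodule ℤ Plane) : Prop :=
  (IsBravaisLattice M ∧ latticeDensity M = δ) ∧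
    ∀ L : Submodule ℤ Plane, IsBravaisLattice L → latticeDensity L = δ →
      E M ≤ E L ∧ (E L = E M ↔ IsRotationOf L M)

/-! Integrability of `f` and `ρ` excludes atoms at exponent `0`, so both are mixtures of Gaussians
`exp (-t |x|²)` with `t > 0`. Convolutions of Gaussians are Gaussian, so by Tonelli the energy is a
positive mixture of theta series `latticeTheta τ L` with `τ > 0`. It therefore suffices to have
Montgomery's theorem with strict inequality for every `τ`. Strictness survives integration because
the mixing measure is nonzero and the energies are finite.

For Montgomery's theorem, scale to unit area and reduce the shape `z = x + i y` to `0 ≤ x ≤ 1/2`,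
`|z| ≥ 1`. Poisson summation exchanges `α` and `1/α` (`quadTheta_inv`), so `α ≥ 1` may be assumed.
The minimum is then reached in two moves.

Horizontally (`quadTheta_half_lt`), Poisson summation along the rows gives a series in `n` with
weights `exp (-π α y n²)`. The `n = ±1` terms strictly favour `x = 1/2` and dominate the later ones.

Vertically (`tsum_exp_eisensteinNorm_lt`), on the line `x = 1/2` the shapes are stretchings of the
triangular lattice. Its sixfold symmetry kills the first-order change of theta. The gain from the
six shortest vectors outweighs any loss from the longer ones. -/

/-! ### Theta function of a shape: Poisson summation and the duality `α ↔ 1/α`. -/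

open Real HurwitzZeta in
lemma hasSum_int_cosKernel_real (a : ℝ) {t : ℝ} (ht : 0 < t) :
    HasSum (fun n : ℤ => Real.exp (-π * n ^ 2 * t) * Real.cos (2 * π * a * n)) (cosKernel a t) := by
  have h := Complex.hasSum_re (hasSum_int_cosKernel a ht)
  simp only [Complex.ofReal_re] at h
  convert h using 2 with n
  rw [mul_comm (Complex.exp _), Complex.re_ofReal_mul]
  have : (2 * π * Complex.I * a * n : ℂ) = ((2 * π * a * n : ℝ) : ℂ) * Complex.I := by
    push_cast; ring
  rw [this, Complex.exp_ofReal_mul_I_re]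

lemma summable_exp_neg_mul_int_sq {κ : ℝ} (hκ : 0 < κ) :
    Summable fun n : ℤ => Real.exp (-κ * (n : ℝ) ^ 2) := by
  have h := (HurwitzZeta.hasSum_int_evenKernel 0 (div_pos hκ Real.pi_pos)).summable
  convert h using 3 with n
  field_simp
  ring

lemma summable_exp_neg_mul_sq_add_sq {κ : ℝ} (hκ : 0 < κ) :
    Summable fun p : ℤ × ℤ => Real.exp (-κ * ((p.1 : ℝ) ^ 2 + (p.2 : ℝ) ^ 2)) := by
  have h := (summable_exp_neg_mul_int_sq hκ).mul_of_nonneg (summable_exp_neg_mul_int_sq hκ)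
    (fun _ => (Real.exp_pos _).le) (fun _ => (Real.exp_pos _).le)
  refine h.congr fun p => ?_
  rw [← Real.exp_add]
  ring_nf

/-- The theta function `∑ exp (-π α |m + n z|² / y)` of the unimodular lattice of shape
`z = x + i y`. -/
noncomputable def quadTheta (α x y : ℝ) : ℝ :=
  ∑' p : ℤ × ℤ, Real.exp (-Real.pi * α * (((p.1 : ℝ) + p.2 * x) ^ 2 + p.2 ^ 2 * y ^ 2) / y)

/-- The Gram matrix `Q` of the form has trace `1 + x² + y²` and determinant `y²`. By
Cayley–Hamilton, `tr Q • Q - det Q = Q²`, which is positive semidefinite; the two squares given to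
`nlinarith` are the entries of `Q v`. -/
lemma norm_form_lower_bound (x : ℝ) {y : ℝ} (hy : 0 < y) (m n : ℝ) :
    y ^ 2 / (1 + x ^ 2 + y ^ 2) * (m ^ 2 + n ^ 2) ≤ (m + n * x) ^ 2 + n ^ 2 * y ^ 2 := by
  rw [div_mul_eq_mul_div, div_le_iff₀ (by positivity)]
  nlinarith [sq_nonneg (m + n * x), sq_nonneg (x * m + (x ^ 2 + y ^ 2) * n)]

lemma summable_quadTheta {α : ℝ} (hα : 0 < α) (x : ℝ) {y : ℝ} (hy : 0 < y) :
    Summable fun p : ℤ × ℤ =>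
      Real.exp (-Real.pi * α * (((p.1 : ℝ) + p.2 * x) ^ 2 + p.2 ^ 2 * y ^ 2) / y) := by
  have hκ : 0 < Real.pi * α / y * (y ^ 2 / (1 + x ^ 2 + y ^ 2)) := by
    have := Real.pi_pos
    positivity
  refine (summable_exp_neg_mul_sq_add_sq hκ).of_nonneg_of_le (fun _ => (Real.exp_pos _).le)
    fun p => Real.exp_le_exp.2 ?_
  have h := mul_le_mul_of_nonneg_left (norm_form_lower_bound x hy p.1 p.2)
    (show 0 ≤ Real.pi * α / y by have := Real.pi_pos; positivity)
  have e : -Real.pi * α * (((p.1 : ℝ) + p.2 * x) ^ 2 + p.2 ^ 2 * y ^ 2) / y =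
    -(Real.pi * α / y * (((p.1 : ℝ) + p.2 * x) ^ 2 + p.2 ^ 2 * y ^ 2)) := by ring
  rw [e]
  linarith

-- Poisson summation in `m` along the row of height `n`: the Gaussian sum shifted by `n x` becomes a
-- cosine series in `n x`.
open Real HurwitzZeta in
lemma hasSum_row_cosKernel {α : ℝ} (hα : 0 < α) (x : ℝ) {y : ℝ} (hy : 0 < y) (n : ℤ) :
    HasSum (fun m : ℤ => Real.exp (-π * α * (((m : ℝ) + n * x) ^ 2 + n ^ 2 * y ^ 2) / y))
      (√(y / α) * (Real.exp (-π * (α * y) * n ^ 2) * cosKernel ((n * x : ℝ) : UnitAddCircle) (y / α))) := by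
  have h := (hasSum_int_evenKernel (n * x) (div_pos hα hy)).mul_left
    (Real.exp (-π * (α * y) * n ^ 2))
  rw [evenKernel_functional_equation, one_div_div, ← Real.sqrt_eq_rpow] at h
  rw [show √(y / α) * (Real.exp (-π * (α * y) * n ^ 2) *
      cosKernel ((n * x : ℝ) : UnitAddCircle) (y / α)) = Real.exp (-π * (α * y) * n ^ 2) *
      (1 / √(α / y) * cosKernel ((n * x : ℝ) : UnitAddCircle) (y / α)) by
    rw [one_div, ← Real.sqrt_inv, inv_div]
    ring]
  refine Eq.mp (congrArg (fun g => HasSum g _) (funext fun m => ?_)) h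
  rw [← Real.exp_add]
  congr 1
  field_simp
  ring

open Real HurwitzZeta in
lemma hasSum_quadTheta {α : ℝ} (hα : 0 < α) (x : ℝ) {y : ℝ} (hy : 0 < y) :
    HasSum (fun n : ℤ => √(y / α) * (Real.exp (-π * (α * y) * n ^ 2) *
      cosKernel ((n * x : ℝ) : UnitAddCircle) (y / α))) (quadTheta α x y) := by
  have h : HasSum (fun p : ℤ × ℤ => Real.exp (-π * α * (((p.swap.1 : ℤ) + (p.swap.2 : ℤ) * x) ^ 2 +
      (p.swap.2 : ℤ) ^ 2 * y ^ 2) / y)) (quadTheta α x y) :=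
    (Equiv.prodComm ℤ ℤ).hasSum_iff.2 (summable_quadTheta hα x hy).hasSum
  exact h.prod_fiberwise fun n => hasSum_row_cosKernel hα x hy n

-- Both sides expand to the double sum of `exp (-π T n² - π X k²) cos (2π x n k)`, whose phase is
-- symmetric in `n` and `k`.
open Real HurwitzZeta in
lemma tsum_exp_mul_cosKernel_comm {T X : ℝ} (hT : 0 < T) (hX : 0 < X) (x : ℝ) :
    ∑' n : ℤ, Real.exp (-π * T * n ^ 2) * cosKernel ((n * x : ℝ) : UnitAddCircle) X =
      ∑' n : ℤ, Real.exp (-π * X * n ^ 2) * cosKernel ((n * x : ℝ) : UnitAddCircle) T := by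
  have expand : ∀ {S U : ℝ}, 0 < U → ∀ n : ℤ,
      Real.exp (-π * S * n ^ 2) * cosKernel ((n * x : ℝ) : UnitAddCircle) U =
      ∑' k : ℤ, Real.exp (-π * S * n ^ 2) * Real.exp (-π * U * k ^ 2) * Real.cos (2 * π * x * n * k) := by
    intro S U hU n
    rw [← ((hasSum_int_cosKernel_real (n * x) hU).mul_left _).tsum_eq]
    refine tsum_congr fun k => ?_
    rw [← mul_assoc]
    congr 3 <;> ring
  simp_rw [expand hX, expand hT]
  rw [Summable.tsum_comm]
  · refine tsum_congr fun n => tsum_congr fun k => ?_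
    rw [mul_comm (Real.exp _) (Real.exp _)]
    congr 2
    ring
  · have hs := (summable_exp_neg_mul_int_sq (mul_pos pi_pos hX)).mul_of_nonneg
      (summable_exp_neg_mul_int_sq (mul_pos pi_pos hT))
      (fun _ => (Real.exp_pos _).le) (fun _ => (Real.exp_pos _).le)
    refine Summable.of_norm_bounded hs fun p => ?_
    simp only [Function.uncurry, norm_mul, Real.norm_eq_abs, Real.abs_exp, neg_mul]
    rw [mul_comm (Real.exp (-(π * T * _)))]
    exact mul_le_of_le_one_right (by positivity) (Real.abs_cos_le_one _)

-- With `T = α y` and `X = y / α`, inverting `α` swaps `T` and `X`. The double sum is unchanged, and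
-- the prefactors `√T` and `√X` have ratio `α`.
open Real HurwitzZeta in
lemma quadTheta_inv {α : ℝ} (hα : 0 < α) (x : ℝ) {y : ℝ} (hy : 0 < y) :
    quadTheta α⁻¹ x y = α * quadTheta α x y := by
  rw [← (hasSum_quadTheta hα x hy).tsum_eq, ← (hasSum_quadTheta (inv_pos.2 hα) x hy).tsum_eq,
    tsum_mul_left, tsum_mul_left, show y / α⁻¹ = α * y by field_simp,
    show α⁻¹ * y = y / α by field_simp,
    tsum_exp_mul_cosKernel_comm (mul_pos hα hy) (div_pos hy hα), ← mul_assoc]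
  congr 1
  rw [Real.sqrt_div hy.le, Real.sqrt_mul hα.le]
  have := Real.sqrt_pos.2 hα
  have h2 := Real.mul_self_sqrt hα.le
  rw [mul_div_assoc', eq_div_iff this.ne']
  linear_combination (√y) * h2

/-! ### Tail estimates for even series. -/

lemma HasSum.even_lower_bound {d : ℤ → ℝ} {S c K r : ℝ} (hd : HasSum d S)
    (heven : ∀ n, d (-n) = d n) (hr : 0 ≤ r) (hr1 : r < 1) (h1 : c ≤ d 1)
    (h2 : ∀ n : ℕ, -(K * r ^ (n + 1)) ≤ d (n + 2)) :
    d 0 + 2 * (c - K * (r / (1 - r))) ≤ S := by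
  -- Folding `n` with `-n` counts the zero term twice, so the folded series sums to `S + d 0`.
  have hS := hd.nat_add_neg
  have hg : HasSum (fun n : ℕ => 2 * -(K * r ^ (n + 1))) (2 * -(K * (r / (1 - r)))) := by
    rw [show (fun n : ℕ => 2 * -(K * r ^ (n + 1))) = fun n => -2 * K * r * r ^ n from
      funext fun n => by ring, show 2 * -(K * (r / (1 - r))) = -2 * K * r * (1 - r)⁻¹ by ring]
    exact (hasSum_geometric_of_lt_one hr hr1).mul_left _
  have hS2 := (hasSum_nat_add_iff' 2).2 hS
  have hle := hasSum_le (fun n : ℕ => ?_) hg hS2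
  · simp only [Finset.sum_range_succ, Finset.sum_range_zero, Nat.cast_zero, Nat.cast_one,
      heven] at hle
    linarith
  · have := h2 n
    push_cast
    rw [heven]
    linarith

/-- Uses `n + 2 ≤ 2 ^ (n + 1)` and `(n + 2)² - 1 = (n + 1)(n + 3) ≥ 3 (n + 1)`. -/
lemma sq_mul_exp_neg_le {t : ℝ} (ht : 0 ≤ t) (n : ℕ) :
    ((n : ℝ) + 2) ^ 2 * Real.exp (-t * ((n : ℝ) + 2) ^ 2) ≤
      Real.exp (-t) * (4 * Real.exp (-3 * t)) ^ (n + 1) := by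
  have h4 : ((n : ℝ) + 2) ^ 2 ≤ 4 ^ (n + 1) := by
    have : n + 2 ≤ 2 ^ (n + 1) := Nat.lt_two_pow_self
    have h : ((n : ℝ) + 2) ≤ 2 ^ (n + 1) := by exact_mod_cast this
    calc ((n : ℝ) + 2) ^ 2 ≤ (2 ^ (n + 1)) ^ 2 := by gcongr
      _ = 4 ^ (n + 1) := by rw [← pow_mul, mul_comm, pow_mul]; norm_num
  rw [mul_pow, ← Real.exp_nat_mul, mul_left_comm, ← Real.exp_add]
  refine mul_le_mul h4 (Real.exp_le_exp.2 ?_) (Real.exp_pos _).le (by positivity)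
  push_cast
  have : (0 : ℝ) ≤ n := n.cast_nonneg
  nlinarith [mul_nonneg ht this, mul_nonneg (mul_nonneg ht this) this]

/-- The terms `n = ±1` contribute at least `2 a exp (-T)`. Quadratic growth of the possible loss
lets a geometric series of ratio `4 exp (-3 T)` control all the others. -/
lemma tsum_exp_mul_pos {c : ℤ → ℝ} {T b a S : ℝ} (hT : 0 ≤ T)
    (hS : HasSum (fun n : ℤ => Real.exp (-T * (n : ℝ) ^ 2) * c n) S)
    (heven : ∀ n, c (-n) = c n) (h0 : c 0 = 0) (h1 : a ≤ c 1) (hb : ∀ n : ℤ, -(b * (n : ℝ) ^ 2) ≤ c n)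
    (hb0 : 0 ≤ b) (hr : 4 * Real.exp (-3 * T) < 1)
    (hab : b * (4 * Real.exp (-3 * T) / (1 - 4 * Real.exp (-3 * T))) < a) : 0 < S := by
  have h := hS.even_lower_bound (c := Real.exp (-T) * a) (K := b * Real.exp (-T))
    (by intro n; simp [heven]) (by positivity) hr
    (by simpa using mul_le_mul_of_nonneg_left h1 (Real.exp_pos (-T)).le) ?_
  · refine lt_of_lt_of_le ?_ h
    rw [h0, mul_zero, zero_add]
    have := mul_lt_mul_of_pos_left hab (Real.exp_pos (-T))
    nlinarith
  · intro n
    have h2 := mul_le_mul_of_nonneg_left (sq_mul_exp_neg_le hT n) hb0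
    have h3 := mul_le_mul_of_nonneg_left (hb (n + 2)) (Real.exp_pos (-T * ((n : ℝ) + 2) ^ 2)).le
    push_cast at h3 ⊢
    nlinarith

lemma sin_nat_mul_sq_le (n : ℕ) (θ : ℝ) : Real.sin (n * θ) ^ 2 ≤ (n : ℝ) ^ 2 * Real.sin θ ^ 2 := by
  have key : |Real.sin (n * θ)| ≤ n * |Real.sin θ| := by
    induction n with
    | zero => simp
    | succ k ih =>
      push_cast
      rw [add_mul, one_mul, Real.sin_add]
      calc _ ≤ |Real.sin (k * θ) * Real.cos θ| + |Real.cos (k * θ) * Real.sin θ| := abs_add_le _ _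
        _ ≤ |Real.sin (k * θ)| + |Real.sin θ| := by
          rw [abs_mul, abs_mul]
          exact add_le_add (mul_le_of_le_one_right (abs_nonneg _) (Real.abs_cos_le_one _))
            (mul_le_of_le_one_left (abs_nonneg _) (Real.abs_cos_le_one _))
        _ ≤ _ := by linarith
  have := pow_le_pow_left₀ (abs_nonneg _) key 2
  simpa [mul_pow] using this

lemma sin_int_mul_sq_le (n : ℤ) (θ : ℝ) : Real.sin (n * θ) ^ 2 ≤ (n : ℝ) ^ 2 * Real.sin θ ^ 2 := by
  obtain ⟨k, rfl | rfl⟩ := n.eq_nat_or_neg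
  · simpa using sin_nat_mul_sq_le k θ
  · simpa [Real.sin_neg] using sin_nat_mul_sq_le k θ

/-! ### Moving the shape horizontally to `x = 1/2`. -/

open Real HurwitzZeta in
lemma hasSum_cosKernel_sub (n : ℤ) (s : ℝ) {X : ℝ} (hX : 0 < X) :
    HasSum (fun k : ℤ => -(Real.exp (-(π * X) * k ^ 2) * (cos (k * (n * π)) * (2 * sin (k * (n * (π * s))) ^ 2))))
      (cosKernel ((n * (1 / 2 - s) : ℝ) : UnitAddCircle) X - cosKernel ((n * (1 / 2) : ℝ) : UnitAddCircle) X) := by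
  have h := (hasSum_int_cosKernel_real (n * (1 / 2 - s)) hX).sub (hasSum_int_cosKernel_real (n * (1 / 2)) hX)
  refine Eq.mp (congrArg (fun g => HasSum g _) (funext fun k => ?_)) h
  have e1 : 2 * π * (n * (1 / 2 - s)) * k = k * (n * π) - 2 * (k * (n * (π * s))) := by ring
  have e2 : 2 * π * (n * (1 / 2)) * k = k * (n * π) := by ring
  have hs : sin (k * (n * π)) = 0 := by
    rw [← mul_assoc, ← Int.cast_mul]; exact Real.sin_int_mul_pi _
  rw [e1, e2, cos_sub, hs, cos_two_mul, cos_sq', show -π * (k : ℝ) ^ 2 * X = -(π * X) * k ^ 2 by ring]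
  ring

lemma summable_sq_mul_exp_neg {t : ℝ} (ht : 0 < t) :
    Summable fun n : ℤ => (n : ℝ) ^ 2 * Real.exp (-t * (n : ℝ) ^ 2) := by
  refine ((summable_exp_neg_mul_int_sq (half_pos ht)).mul_left (2 / t)).of_nonneg_of_le
    (fun _ => by positivity) fun n => ?_
  have h := Real.add_one_le_exp (t / 2 * (n : ℝ) ^ 2)
  have e : Real.exp (-t * (n : ℝ) ^ 2) = Real.exp (-(t / 2) * (n : ℝ) ^ 2) * Real.exp (-(t / 2 * (n : ℝ) ^ 2)) := by
    rw [← Real.exp_add]; ring_nf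
  have hE := Real.exp_pos (t / 2 * (n : ℝ) ^ 2)
  have h2 : (n : ℝ) ^ 2 * Real.exp (-(t / 2 * (n : ℝ) ^ 2)) ≤ 2 / t := by
    rw [Real.exp_neg, ← div_eq_mul_inv, div_le_div_iff₀ hE ht]
    linarith
  rw [e]
  have := mul_le_mul_of_nonneg_right h2 (Real.exp_pos (-(t / 2) * (n : ℝ) ^ 2)).le
  linarith

-- Used when `X` is not small. For `n = 1` the terms `k = ±1` give the main part `4 exp (-π X) sin²
-- (π s)`, the sign being positive because `cos π = -1`. The factor `sin² (π s)` is kept in both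
-- bounds, via `|sin (nθ)| ≤ n |sin θ|`, so that they stay comparable as `s → 0`.
open Real HurwitzZeta in
lemma cosKernel_sub_bounds {X : ℝ} (hX : 0 < X) (hq : 4 * Real.exp (-3 * (π * X)) < 1) {κ : ℝ}
    (hκ : 4 * Real.exp (-3 * (π * X)) / (1 - 4 * Real.exp (-3 * (π * X))) = κ) (s : ℝ) :
    4 * exp (-(π * X)) * (1 - κ) * sin (π * s) ^ 2 ≤
      cosKernel (((1 : ℤ) * (1 / 2 - s) : ℝ) : UnitAddCircle) X - cosKernel (((1 : ℤ) * (1 / 2) : ℝ) : UnitAddCircle) X ∧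
    ∀ n : ℤ, -(4 * exp (-(π * X)) * (1 + κ) * sin (π * s) ^ 2 * (n : ℝ) ^ 2) ≤
      cosKernel ((n * (1 / 2 - s) : ℝ) : UnitAddCircle) X - cosKernel ((n * (1 / 2) : ℝ) : UnitAddCircle) X := by
  have hpX : 0 ≤ π * X := by positivity
  set w := sin (π * s) ^ 2 with hw
  have hw0 : 0 ≤ w := sq_nonneg _
  constructor
  · have h := (hasSum_cosKernel_sub 1 s hX).even_lower_bound (c := 2 * exp (-(π * X)) * w)
      (K := 2 * w * exp (-(π * X))) (by intro n; simp [Real.sin_neg]) (by positivity) hq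
      (by simp [hw]; linarith) ?_
    · refine le_trans (le_of_eq ?_) h
      rw [hκ]
      simp
      ring
    · intro n
      have h1 := sq_mul_exp_neg_le hpX n
      have h2 := sin_int_mul_sq_le (n + 2) (π * s)
      push_cast at h2 ⊢
      rw [one_mul, one_mul]
      have h3 := neg_le_of_abs_le (Real.abs_cos_le_one (((n : ℝ) + 2) * π))
      have h4 := Real.cos_le_one (((n : ℝ) + 2) * π)
      have h5 : 2 * Real.exp (-(π * X) * ((n : ℝ) + 2) ^ 2) * sin (((n : ℝ) + 2) * (π * s)) ^ 2 ≤
         2 * w * (Real.exp (-(π * X)) * (4 * Real.exp (-3 * (π * X))) ^ (n + 1)) := by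
        calc _ ≤ 2 * Real.exp (-(π * X) * ((n : ℝ) + 2) ^ 2) * (((n : ℝ) + 2) ^ 2 * w) := by gcongr
          _ = 2 * w * (((n : ℝ) + 2) ^ 2 * Real.exp (-(π * X) * ((n : ℝ) + 2) ^ 2)) := by ring
          _ ≤ _ := by gcongr
      have h6 := mul_le_mul_of_nonneg_left h4 (show 0 ≤ 2 * Real.exp (-(π * X) * ((n : ℝ) + 2) ^ 2) *
        sin (((n : ℝ) + 2) * (π * s)) ^ 2 by positivity)
      linarith
  · intro n
    have hsum := (summable_sq_mul_exp_neg (mul_pos pi_pos hX)).hasSum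
    set Z := ∑' k : ℤ, (k : ℝ) ^ 2 * Real.exp (-(π * X) * (k : ℝ) ^ 2) with hZ
    have hB : 2 * Z ≤ 4 * exp (-(π * X)) * (1 + κ) := by
      -- Applied to the negated series, the lower bound becomes an upper bound for `Z`.
      have h := hsum.neg.even_lower_bound (c := - exp (-(π * X))) (K := exp (-(π * X)))
        (by intro n; simp) (by positivity) hq (by simp) (fun n => by
          have := sq_mul_exp_neg_le hpX n
          push_cast
          linarith)
      rw [hκ] at h
      simp at h
      linarith
    have h := hasSum_le (fun k : ℤ => ?_) (hsum.mul_left (-(2 * w * (n : ℝ) ^ 2))) (hasSum_cosKernel_sub n s hX)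
    · have := mul_le_mul_of_nonneg_right hB (show 0 ≤ w * (n : ℝ) ^ 2 by positivity)
      linarith
    · have h2 := sin_int_mul_sq_le (k * n) (π * s)
      push_cast at h2
      rw [mul_assoc] at h2
      have h4 := Real.cos_le_one (k * (n * π))
      set E := Real.exp (-(π * X) * (k : ℝ) ^ 2)
      have hE : 0 < E := Real.exp_pos _
      have h6 := mul_le_mul_of_nonneg_left h4 (show 0 ≤ E * (2 * sin (k * (n * (π * s))) ^ 2) by positivity)
      have h7 := mul_le_mul_of_nonneg_left h2 hE.le
      linarith

lemma one_add_cubic_le_exp {x : ℝ} (hx : 0 ≤ x) : 1 + x + x ^ 2 / 2 + x ^ 3 / 6 ≤ Real.exp x := by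
  have := Real.sum_le_exp_of_nonneg hx 4
  simp [Finset.sum_range_succ, Nat.factorial] at this
  linarith

/-- Apply `exp u ≥ 1 + u` to both shifted terms, relative to the central one; the parts odd in `σ`
cancel. -/
lemma neg_mul_exp_le_exp_add_exp_sub (a j σ : ℝ) :
    -(2 * (a * σ ^ 2)) * Real.exp (-a * j ^ 2) ≤
      Real.exp (-a * (j - σ) ^ 2) + Real.exp (-a * (j + σ) ^ 2) - 2 * Real.exp (-a * j ^ 2) := by
  have e1 : Real.exp (-a * (j - σ) ^ 2) = Real.exp (-a * j ^ 2) * Real.exp (2 * a * j * σ - a * σ ^ 2) := by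
    rw [← Real.exp_add]; ring_nf
  have e2 : Real.exp (-a * (j + σ) ^ 2) = Real.exp (-a * j ^ 2) * Real.exp (-(2 * a * j * σ) - a * σ ^ 2) := by
    rw [← Real.exp_add]; ring_nf
  have h1 := Real.add_one_le_exp (2 * a * j * σ - a * σ ^ 2)
  have h2 := Real.add_one_le_exp (-(2 * a * j * σ) - a * σ ^ 2)
  rw [e1, e2]
  nlinarith [Real.exp_pos (-a * j ^ 2)]

lemma exp_add_exp_half_lower {a s : ℝ} (ha : 12 ≤ a) (hs : 0 ≤ s) (hs2 : s ≤ 1 / 2) :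
    a * s ^ 2 / 2 * Real.exp (-a * (1 / 2) ^ 2) ≤
      Real.exp (-a * (1 / 2 - s) ^ 2) + Real.exp (-a * (1 / 2 + s) ^ 2) -
        2 * Real.exp (-a * (1 / 2) ^ 2) := by
  have e1 : Real.exp (-a * (1 / 2 - s) ^ 2) = Real.exp (-a * (1 / 2) ^ 2) * Real.exp (a * s * (1 - s)) := by
    rw [← Real.exp_add]; ring_nf
  have e2 : Real.exp (-a * (1 / 2 + s) ^ 2) = Real.exp (-a * (1 / 2) ^ 2) * Real.exp (-(a * s * (1 + s))) := by
    rw [← Real.exp_add]; ring_nf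
  have h1 := one_add_cubic_le_exp (show 0 ≤ a * s * (1 - s) by
    have : 0 ≤ 1 - s := by linarith
    positivity)
  have h2 := Real.add_one_le_exp (-(a * s * (1 + s)))
  have ht : 0 ≤ 1 - s := by linarith
  -- The case `a = 12` of the required bound. The value `5/2` is the claimed `1/2` plus the `2` lost
  -- because the linear terms add up to `-2 a s²`.
  have poly : 5 / 2 ≤ 6 * (1 - s) ^ 2 + 24 * s * (1 - s) ^ 3 := by
    nlinarith [mul_nonneg hs (sub_nonneg.2 hs2), mul_nonneg (mul_nonneg hs (sub_nonneg.2 hs2)) ht,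
      mul_nonneg (mul_nonneg (mul_nonneg hs (sub_nonneg.2 hs2)) ht) hs]
  have h3 : 5 / 2 ≤ a * (1 - s) ^ 2 / 2 + a ^ 2 * s * (1 - s) ^ 3 / 6 := by
    have : 12 * (1 - s) ^ 2 / 2 ≤ a * (1 - s) ^ 2 / 2 := by gcongr
    have : 12 ^ 2 * s * (1 - s) ^ 3 / 6 ≤ a ^ 2 * s * (1 - s) ^ 3 / 6 := by gcongr
    linarith
  have h4 := mul_le_mul_of_nonneg_left h3 (show 0 ≤ a * s ^ 2 by positivity)
  rw [e1, e2]
  nlinarith [Real.exp_pos (-a * (1 / 2) ^ 2)]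

/-- The second difference has the sign of `exp (-a s²) cosh (2 a s j) - 1`, which increases with
`|j|`; so `j = 1/2` is the worst case. -/
lemma exp_add_exp_sub_nonneg {a s j : ℝ} (ha : 12 ≤ a) (hs : 0 ≤ s) (hs2 : s ≤ 1 / 2)
    (hj : 1 / 2 ≤ |j|) :
    0 ≤ Real.exp (-a * (j - s) ^ 2) + Real.exp (-a * (j + s) ^ 2) - 2 * Real.exp (-a * j ^ 2) := by
  have e : ∀ j : ℝ, Real.exp (-a * (j - s) ^ 2) + Real.exp (-a * (j + s) ^ 2) -
      2 * Real.exp (-a * j ^ 2) =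
      2 * Real.exp (-a * j ^ 2) * (Real.exp (-a * s ^ 2) * Real.cosh (2 * a * s * j) - 1) := by
    intro j
    have e1 : Real.exp (-a * (j - s) ^ 2) =
        Real.exp (-a * j ^ 2) * Real.exp (-a * s ^ 2) * Real.exp (2 * a * s * j) := by
      rw [← Real.exp_add, ← Real.exp_add]; ring_nf
    have e2 : Real.exp (-a * (j + s) ^ 2) =
        Real.exp (-a * j ^ 2) * Real.exp (-a * s ^ 2) * Real.exp (-(2 * a * s * j)) := by
      rw [← Real.exp_add, ← Real.exp_add]; ring_nf
    rw [Real.cosh_eq, e1, e2]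
    ring
  have h0 := exp_add_exp_half_lower ha hs hs2
  rw [e] at h0 ⊢
  have h1 : 0 ≤ 2 * Real.exp (-a * (1 / 2) ^ 2) *
      (Real.exp (-a * s ^ 2) * Real.cosh (2 * a * s * (1 / 2)) - 1) := le_trans (by positivity) h0
  have h2 := nonneg_of_mul_nonneg_right h1 (by positivity)
  have h3 : Real.cosh (2 * a * s * (1 / 2)) ≤ Real.cosh (2 * a * s * j) := by
    rw [Real.cosh_le_cosh, abs_mul, abs_mul _ j, abs_of_pos (show (0 : ℝ) < 1 / 2 by norm_num)]
    gcongr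
  have h4 := mul_le_mul_of_nonneg_left h3 (Real.exp_pos (-a * s ^ 2)).le
  exact mul_nonneg (by positivity) (by linarith)

open Real HurwitzZeta in
lemma cosKernel_eq_evenKernel (a : UnitAddCircle) (X : ℝ) :
    cosKernel a X = (1 / X) ^ (1 / 2 : ℝ) * evenKernel a (1 / X) := by
  rcases le_or_gt X 0 with h | h
  · rw [cosKernel_undef _ h, evenKernel_undef _ (div_nonpos_of_nonneg_of_nonpos zero_le_one h), mul_zero]
  · rw [evenKernel_functional_equation, one_div_one_div, ← mul_assoc, mul_one_div_cancel, one_mul]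
    positivity

open Real HurwitzZeta in
lemma cosKernel_le_cosKernel_zero (a : ℝ) {X : ℝ} (hX : 0 < X) :
    cosKernel (a : UnitAddCircle) X ≤ cosKernel ((0 : ℝ) : UnitAddCircle) X := by
  refine hasSum_le (fun k => ?_) (hasSum_int_cosKernel_real a hX) (hasSum_int_cosKernel_real 0 hX)
  have := mul_le_mul_of_nonneg_left (cos_le_one (2 * π * a * k)) (exp_pos (-π * k ^ 2 * X)).le
  simpa using this

open Real HurwitzZeta in
lemma evenKernel_le_two (a : ℝ) {t : ℝ} (ht : 1 ≤ t) : evenKernel (a : UnitAddCircle) t ≤ 2 := by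
  have ht0 : 0 < t := by linarith
  have h1 : evenKernel (a : UnitAddCircle) t ≤ evenKernel ((0 : ℝ) : UnitAddCircle) t := by
    rw [evenKernel_functional_equation, evenKernel_functional_equation]
    exact mul_le_mul_of_nonneg_left (cosKernel_le_cosKernel_zero a (by positivity)) (by positivity)
  refine h1.trans ?_
  set E := Real.exp (-π * t)
  have hE : E ≤ 1 / 4 := by
    have h3 : (3 : ℝ) ≤ π * t := by nlinarith [pi_gt_three]
    have : E ≤ Real.exp (-3) := Real.exp_le_exp.2 (by linarith)
    have h4 := Real.add_one_le_exp (3 : ℝ)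
    rw [Real.exp_neg, inv_eq_one_div] at this
    refine this.trans (one_div_le_one_div_of_le (by norm_num) (by linarith))
  have hE0 : 0 < E := Real.exp_pos _
  have h := (hasSum_int_evenKernel 0 ht0).neg.even_lower_bound (c := -E) (K := E) (r := E)
    (by intro n; simp) hE0.le (by linarith) (by simp [E]) (fun n => ?_)
  · have h5 : E / (1 - E) ≤ 1 / 3 := by
      rw [div_le_iff₀ (by linarith)]; linarith
    have h6 : E * (E / (1 - E)) ≤ E * (1 / 3) := mul_le_mul_of_nonneg_left h5 hE0.le
    simp at h
    simp
    linarith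
  · rw [neg_le_neg_iff, ← pow_succ', ← Real.exp_nat_mul]
    refine Real.exp_le_exp.2 ?_
    push_cast
    have : (0 : ℝ) ≤ n := n.cast_nonneg
    have hp : 0 < π * t := by positivity
    nlinarith [mul_nonneg hp.le this, mul_nonneg (mul_nonneg hp.le this) this]

-- The reflection `m ↦ -n - m` gives a second copy of the shifted series. Adding the two turns the
-- difference into second differences of a Gaussian at the points `m + n / 2`.
open Real HurwitzZeta in
lemma hasSum_evenKernel_sub (n : ℤ) (s : ℝ) {X : ℝ} (hX : 0 < X) :
    HasSum (fun m : ℤ => Real.exp (-(π / X) * ((m + n / 2 : ℝ) - n * s) ^ 2) +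
        Real.exp (-(π / X) * ((m + n / 2 : ℝ) + n * s) ^ 2) - 2 * Real.exp (-(π / X) * (m + n / 2 : ℝ) ^ 2))
      (2 * (evenKernel ((n * (1 / 2 - s) : ℝ) : UnitAddCircle) (1 / X) -
        evenKernel ((n * (1 / 2) : ℝ) : UnitAddCircle) (1 / X))) := by
  have hX' : 0 < 1 / X := by positivity
  have h1 := hasSum_int_evenKernel (n * (1 / 2 - s)) hX'
  have h2 := (Equiv.subLeft (-n)).hasSum_iff.2 h1
  have h3 := (hasSum_int_evenKernel (n * (1 / 2)) hX').mul_left 2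
  rw [mul_sub, two_mul]
  refine Eq.mp (congrArg (fun g => HasSum g _) (funext fun m => ?_)) ((h1.add h2).sub h3)
  simp only [Function.comp, Equiv.subLeft_apply]
  push_cast
  ring_nf

-- Used for small `X`, where the cosine series converges slowly and its Poisson dual is a sum of
-- narrow Gaussians. For `n = 1` the two points `±1/2` give the main part, and the other
-- half-integers contribute nonnegatively.
open Real HurwitzZeta in
lemma cosKernel_sub_bounds_of_small {X : ℝ} (hX : 0 < X) (ha : 12 ≤ π / X) {s : ℝ} (hs : 0 ≤ s)
    (hs2 : s ≤ 1 / 2) :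
    (1 / X) ^ (1 / 2 : ℝ) * (π / X * s ^ 2 / 2 * Real.exp (-(π / X) / 4)) ≤
      cosKernel (((1 : ℤ) * (1 / 2 - s) : ℝ) : UnitAddCircle) X - cosKernel (((1 : ℤ) * (1 / 2) : ℝ) : UnitAddCircle) X ∧
    ∀ n : ℤ, -((1 / X) ^ (1 / 2 : ℝ) * (2 * (π / X) * s ^ 2) * (n : ℝ) ^ 2) ≤
      cosKernel ((n * (1 / 2 - s) : ℝ) : UnitAddCircle) X - cosKernel ((n * (1 / 2) : ℝ) : UnitAddCircle) X := by
  have hγ : 0 < (1 / X) ^ (1 / 2 : ℝ) := by positivity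
  have hX1 : 1 ≤ 1 / X := by
    have h4 := pi_lt_four
    rw [le_div_iff₀ hX] at ha ⊢
    linarith
  simp only [cosKernel_eq_evenKernel _ X, ← mul_sub]
  have hterm : ∀ (n m : ℤ), -(2 * ((π / X) * (n * s) ^ 2)) * Real.exp (-(π / X) * (m + n / 2 : ℝ) ^ 2) ≤ _ :=
    fun n m => neg_mul_exp_le_exp_add_exp_sub (π / X) (m + n / 2) (n * s)
  constructor
  · refine mul_le_mul_of_nonneg_left ?_ hγ.le
    have h := hasSum_evenKernel_sub 1 s hX
    have hj : ∀ j : ℝ, 1 / 2 ≤ |j| → 0 ≤ Real.exp (-(π / X) * (j - s) ^ 2) +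
        Real.exp (-(π / X) * (j + s) ^ 2) - 2 * Real.exp (-(π / X) * j ^ 2) := by
      exact fun j hj => exp_add_exp_sub_nonneg ha hs hs2 hj
    have hle := sum_le_hasSum {0, -1} (fun m _ => ?_) h
    · rw [Finset.sum_pair (by norm_num)] at hle
      have h0 := exp_add_exp_half_lower ha hs hs2
      push_cast at hle
      rw [show ((0 : ℝ) + 1 / 2 - 1 * s) = 1 / 2 - s by ring, show ((0 : ℝ) + 1 / 2 + 1 * s) = 1 / 2 + s by ring,
        show ((-1 : ℝ) + 1 / 2 - 1 * s) = -(1 / 2 + s) by ring,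
        show ((-1 : ℝ) + 1 / 2 + 1 * s) = -(1 / 2 - s) by ring,
        show ((-1 : ℝ) + 1 / 2) = -(1 / 2) by ring, show ((0 : ℝ) + 1 / 2) = 1 / 2 by ring,
        neg_sq, neg_sq, neg_sq] at hle
      rw [show -(π / X) / 4 = -(π / X) * (1 / 2) ^ 2 by ring]
      push_cast
      linarith
    · have := hj (m + 1 / 2) ?_
      · simpa using this
      · rw [le_abs]
        rcases le_or_gt 0 m with hm | hm
        · left
          have : (0 : ℝ) ≤ m := by exact_mod_cast hm
          linarith
        · right
          have : (m : ℝ) ≤ -1 := by exact_mod_cast Int.le_sub_one_of_lt hm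
          linarith
  · intro n
    rw [mul_assoc, ← mul_neg]
    refine mul_le_mul_of_nonneg_left ?_ hγ.le
    have h3 := (hasSum_int_evenKernel (n * (1 / 2)) (show 0 < 1 / X by positivity)).mul_left
      (-(2 * ((π / X) * (n * s) ^ 2)))
    have hle := hasSum_le (fun m => ?_) h3 (hasSum_evenKernel_sub n s hX)
    · have h2 := mul_le_mul_of_nonneg_left (evenKernel_le_two (n * (1 / 2)) hX1)
        (show 0 ≤ (2 * ((π / X) * (n * s) ^ 2)) by positivity)
      linarith
    · refine le_trans (le_of_eq ?_) (hterm n m)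
      congr 2
      ring

open Real HurwitzZeta in
/-- For fixed `y` the theta function is smallest at `x = 1 / 2`. -/
lemma quadTheta_half_lt {α x y : ℝ} (hα : 1 ≤ α) (hx : 0 ≤ x) (hx2 : x < 1 / 2) (hy : 0 < y)
    (hxy : 1 ≤ x ^ 2 + y ^ 2) : quadTheta α (1 / 2) y < quadTheta α x y := by
  have hα0 : 0 < α := by linarith
  obtain ⟨s, rfl⟩ : ∃ s, x = 1 / 2 - s := ⟨1 / 2 - x, by ring⟩
  have hs : 0 < s := by linarith
  have hs2 : s ≤ 1 / 2 := by linarith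
  have hy2 : 3 / 4 ≤ y ^ 2 := by nlinarith
  have hy1 : 0.86 ≤ y := by nlinarith
  have hX : 0 < y / α := div_pos hy hα0
  have hT : 0 < α * y := by positivity
  have hTX : 3 / 4 ≤ (α * y) * (y / α) := by
    rw [show (α * y) * (y / α) = y ^ 2 by field_simp]; exact hy2
  have hT1 : 0.86 ≤ α * y := by nlinarith
  have h := (hasSum_quadTheta hα0 (1 / 2 - s) hy).sub (hasSum_quadTheta hα0 (1 / 2) hy)
  -- With `X = y / α` and `T = α y`, the estimates need only `X > 0`, `T ≥ 0.86` and `T X = y² ≥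
  -- 3/4`. The constant `0.86` lies just below `√3 / 2`.
  rw [← sub_pos]
  generalize y / α = X at *
  generalize α * y = T at *
  have hγ : 0 < √X := Real.sqrt_pos.2 hX
  rw [← mul_pos_iff_of_pos_left (inv_pos.2 hγ)]
  have h2 : HasSum (fun n : ℤ => Real.exp (-(π * T) * (n : ℝ) ^ 2) *
      (cosKernel ((n * (1 / 2 - s) : ℝ) : UnitAddCircle) X -
        cosKernel ((n * (1 / 2) : ℝ) : UnitAddCircle) X))
      ((√X)⁻¹ * (quadTheta α (1 / 2 - s) y - quadTheta α (1 / 2) y)) := by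
    refine Eq.mp (congrArg (fun g => HasSum g _) (funext fun n => ?_)) (h.mul_left (√X)⁻¹)
    rw [← mul_sub, ← mul_assoc, inv_mul_cancel₀ hγ.ne', one_mul, ← mul_sub, neg_mul]
  have heven : ∀ n : ℤ, cosKernel (((-n : ℤ) * (1 / 2 - s) : ℝ) : UnitAddCircle) X -
        cosKernel (((-n : ℤ) * (1 / 2) : ℝ) : UnitAddCircle) X =
      cosKernel ((n * (1 / 2 - s) : ℝ) : UnitAddCircle) X -
        cosKernel ((n * (1 / 2) : ℝ) : UnitAddCircle) X := by
    intro n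
    push_cast
    rw [neg_mul, neg_mul, AddCircle.coe_neg, AddCircle.coe_neg, cosKernel_neg, cosKernel_neg]
  have h0 : cosKernel (((0 : ℤ) * (1 / 2 - s) : ℝ) : UnitAddCircle) X -
        cosKernel (((0 : ℤ) * (1 / 2) : ℝ) : UnitAddCircle) X = 0 := by simp
  have hpT : 8 ≤ 3 * (π * T) := by nlinarith [pi_gt_d2]
  have e8 : Real.exp (-8) ≤ 1 / 2400 := by
    rw [Real.exp_neg, inv_eq_one_div]
    refine one_div_le_one_div_of_le (by norm_num) ?_
    have h1 := Real.exp_one_gt_d9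
    calc (2400 : ℝ) ≤ 2.7 ^ 8 := by norm_num
      _ ≤ Real.exp 1 ^ 8 := by gcongr; linarith
      _ = Real.exp 8 := by rw [← Real.exp_nat_mul]; norm_num
  have hr : Real.exp (-3 * (π * T)) ≤ 1 / 2400 := le_trans (Real.exp_le_exp.2 (by linarith)) e8
  have hr0 := Real.exp_pos (-3 * (π * T))
  have hκ : 4 * Real.exp (-3 * (π * T)) / (1 - 4 * Real.exp (-3 * (π * T))) ≤
      5 * Real.exp (-3 * (π * T)) := by
    rw [div_le_iff₀ (by linarith)]
    nlinarith
  -- Above the threshold `X = π / 12` the cosine series is effective, with `exp (-3 π X) ≤ 0.09`;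
  -- below it the Gaussian series is used.
  rcases le_total (π / X) 12 with ha | ha
  · have hq : Real.exp (-3 * (π * X)) ≤ 0.09 := by
      have h1 : 2.4375 ≤ 3 * (π * X) := by
        rw [div_le_iff₀ hX] at ha
        nlinarith [pi_gt_d2]
      have h2 : Real.exp (-3 * (π * X)) ≤ Real.exp (-2.4375) := Real.exp_le_exp.2 (by linarith)
      refine h2.trans ?_
      rw [Real.exp_neg, inv_le_comm₀ (Real.exp_pos _) (by norm_num)]
      have h1 := Real.exp_one_gt_d9
      have h3 := one_add_cubic_le_exp (show (0 : ℝ) ≤ 0.4375 by norm_num)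
      calc ((0.09 : ℝ)⁻¹) ≤ 2.718 ^ 2 * (1 + 0.4375 + 0.4375 ^ 2 / 2 + 0.4375 ^ 3 / 6) := by norm_num
        _ ≤ Real.exp 1 ^ 2 * Real.exp 0.4375 := by gcongr; linarith
        _ = Real.exp 2.4375 := by rw [← Real.exp_nat_mul, ← Real.exp_add]; norm_num
    have hq0 := Real.exp_pos (-3 * (π * X))
    have hκX : 4 * Real.exp (-3 * (π * X)) / (1 - 4 * Real.exp (-3 * (π * X))) ≤ 0.5625 := by
      rw [div_le_iff₀ (by linarith)]
      linarith
    have hκ0 : 0 ≤ 4 * Real.exp (-3 * (π * X)) / (1 - 4 * Real.exp (-3 * (π * X))) :=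
      div_nonneg (by positivity) (by linarith)
    obtain ⟨h1, hb⟩ := cosKernel_sub_bounds hX (by linarith) rfl s
    generalize 4 * Real.exp (-3 * (π * X)) / (1 - 4 * Real.exp (-3 * (π * X))) = κ at *
    have hw : 0 < sin (π * s) ^ 2 := by
      have := sin_pos_of_pos_of_lt_pi (mul_pos pi_pos hs) (by nlinarith [pi_pos])
      positivity
    refine tsum_exp_mul_pos (by positivity) h2 heven h0 h1 hb (by positivity) (by linarith) ?_
    have hE : 0 < 4 * Real.exp (-(π * X)) * sin (π * s) ^ 2 := by positivity
    have h3 : (1 + κ) * (4 * Real.exp (-3 * (π * T)) / (1 - 4 * Real.exp (-3 * (π * T)))) < 1 - κ := by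
      have := mul_le_mul_of_nonneg_left hκ (show 0 ≤ 1 + κ by linarith)
      nlinarith
    have := mul_lt_mul_of_pos_left h3 hE
    linarith
  · obtain ⟨h1, hb⟩ := cosKernel_sub_bounds_of_small hX ha hs.le hs2
    refine tsum_exp_mul_pos (by positivity) h2 heven h0 h1 hb (by positivity) (by linarith) ?_
    have hE : 0 < (1 / X) ^ (1 / 2 : ℝ) * (π / X * s ^ 2 / 2) := by positivity
    have h3 : 4 * (4 * Real.exp (-3 * (π * T)) / (1 - 4 * Real.exp (-3 * (π * T)))) <
        Real.exp (-(π / X) / 4) := by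
      -- The main term is only of size `exp (-π / (4 X))`, but `T X ≥ 3/4` makes the tail in `n`
      -- still smaller.
      have h4 : 9 / 4 * (π / X) ≤ 3 * (π * T) := by
        rw [mul_div_assoc', div_le_iff₀ hX]
        nlinarith [pi_pos]
      have h5 : Real.exp (-3 * (π * T)) ≤ Real.exp (-(π / X) / 4) * Real.exp (-8) := by
        rw [← Real.exp_add]
        exact Real.exp_le_exp.2 (by linarith)
      have h6 := Real.exp_pos (-(π / X) / 4)
      nlinarith
    have := mul_lt_mul_of_pos_left h3 hE
    linarith

/-! ### Moving the shape down the line `x = 1/2` to the triangular lattice. -/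

lemma cubic_le_exp_neg {y : ℝ} (hy : 0 ≤ y) : 1 - y + y ^ 2 / 2 - y ^ 3 / 6 ≤ Real.exp (-y) := by
  have hd : ∀ x : ℝ, HasDerivAt (fun x => Real.exp x * (1 - x + x ^ 2 / 2 - x ^ 3 / 6))
      (-(Real.exp x * x ^ 3 / 6)) x := by
    intro x
    have h1 := (((hasDerivAt_id x).const_sub 1).add ((hasDerivAt_pow 2 x).div_const 2)).sub
      ((hasDerivAt_pow 3 x).div_const 6)
    refine ((Real.hasDerivAt_exp x).mul h1).congr_deriv ?_
    simp
    ring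
  have hanti : AntitoneOn (fun x => Real.exp x * (1 - x + x ^ 2 / 2 - x ^ 3 / 6)) (Ici 0) := by
    refine antitoneOn_of_deriv_nonpos (convex_Ici 0) (fun x _ => (hd x).continuousAt.continuousWithinAt)
      (fun x _ => (hd x).differentiableAt.differentiableWithinAt) fun x hx => ?_
    rw [interior_Ici] at hx
    have : 0 < x := hx
    rw [(hd x).deriv]
    have := Real.exp_pos x
    simp only [Left.neg_nonpos_iff]
    positivity
  have h := hanti (mem_Ici.2 le_rfl) (mem_Ici.2 hy) hy
  simp at h
  rw [Real.exp_neg, ← one_div, le_div_iff₀ (Real.exp_pos y)]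
  linarith

/-- The rotation by `π / 3` in the coordinates of the Eisenstein lattice. -/
def eisensteinRotation : ℤ × ℤ ≃ ℤ × ℤ where
  toFun p := (-p.2, p.1 + p.2)
  invFun p := (p.1 + p.2, -p.1)
  left_inv p := by ext <;> simp
  right_inv p := by ext <;> simp

/-- The norm form of the Eisenstein lattice. -/
def eisensteinNorm (p : ℤ × ℤ) : ℝ := (p.1 : ℝ) ^ 2 + p.1 * p.2 + (p.2 : ℝ) ^ 2

/-- The derivative of the norm form of the Eisenstein lattice under an area preserving stretching
along the first basis vector. -/
def eisensteinStretch (p : ℤ × ℤ) : ℝ := 2 * (p.1 : ℝ) ^ 2 + 2 * p.1 * p.2 - (p.2 : ℝ) ^ 2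

lemma sq_add_sq_le_eisensteinNorm (p : ℤ × ℤ) :
    ((p.1 : ℝ) ^ 2 + (p.2 : ℝ) ^ 2) / 2 ≤ eisensteinNorm p := by
  unfold eisensteinNorm
  nlinarith [sq_nonneg ((p.1 : ℝ) + p.2)]

lemma abs_eisensteinStretch_le (p : ℤ × ℤ) : |eisensteinStretch p| ≤ 4 * eisensteinNorm p := by
  unfold eisensteinNorm eisensteinStretch
  rw [abs_le]
  constructor <;> nlinarith [sq_nonneg ((p.1 : ℝ) + p.2), sq_nonneg (p.1 : ℝ), sq_nonneg (p.2 : ℝ)]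

lemma summable_exp_eisensteinNorm {c : ℝ} (hc : 0 < c) :
    Summable fun p : ℤ × ℤ => Real.exp (-c * eisensteinNorm p) := by
  refine (summable_exp_neg_mul_sq_add_sq (half_pos hc)).of_nonneg_of_le (fun _ => (Real.exp_pos _).le)
    fun p => Real.exp_le_exp.2 ?_
  nlinarith [sq_add_sq_le_eisensteinNorm p]

lemma summable_eisensteinStretch_mul_exp {c : ℝ} (hc : 0 < c) :
    Summable fun p : ℤ × ℤ => eisensteinStretch p * Real.exp (-c * eisensteinNorm p) := by
  refine Summable.of_norm_bounded ((summable_exp_eisensteinNorm (half_pos hc)).mul_left (8 / c)) fun p => ?_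
  rw [norm_mul, Real.norm_eq_abs, Real.norm_eq_abs, Real.abs_exp]
  have h := Real.add_one_le_exp (c / 2 * eisensteinNorm p)
  have e : Real.exp (-c * eisensteinNorm p) =
      Real.exp (-(c / 2) * eisensteinNorm p) * Real.exp (-(c / 2 * eisensteinNorm p)) := by
    rw [← Real.exp_add]; ring_nf
  have hE := Real.exp_pos (c / 2 * eisensteinNorm p)
  have h2 : |eisensteinStretch p| * Real.exp (-(c / 2 * eisensteinNorm p)) ≤ 8 / c := by
    rw [Real.exp_neg, ← div_eq_mul_inv, div_le_div_iff₀ hE hc]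
    nlinarith [abs_eisensteinStretch_le p]
  rw [e]
  have := mul_le_mul_of_nonneg_right h2 (Real.exp_pos (-(c / 2) * eisensteinNorm p)).le
  linarith

/-- The triangular lattice is a critical point of the theta function. -/
lemma tsum_eisensteinStretch_mul_exp {c : ℝ} (hc : 0 < c) :
    ∑' p : ℤ × ℤ, eisensteinStretch p * Real.exp (-c * eisensteinNorm p) = 0 := by
  set F := fun p : ℤ × ℤ => eisensteinStretch p * Real.exp (-c * eisensteinNorm p) with hF
  have hs : Summable F := summable_eisensteinStretch_mul_exp hc
  have h1 : HasSum (F ∘ eisensteinRotation) (∑' p, F p) := eisensteinRotation.hasSum_iff.2 hs.hasSum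
  have h2 : HasSum ((F ∘ eisensteinRotation) ∘ eisensteinRotation) (∑' p, F p) :=
    eisensteinRotation.hasSum_iff.2 h1
  have h3 := (hs.hasSum.add h1).add h2
  -- The stretch form is trace-free with respect to the norm form, so its values at a vector and at
  -- its rotations by `π / 3` and `2π / 3` add up to zero.
  have h4 : HasSum (fun p => F p + (F ∘ eisensteinRotation) p +
      ((F ∘ eisensteinRotation) ∘ eisensteinRotation) p) 0 := by
    refine Eq.mp (congrArg (fun g => HasSum g 0) (funext fun p => ?_)) hasSum_zero
    simp only [Function.comp, hF]
    have e : ∀ q, eisensteinNorm (eisensteinRotation q) = eisensteinNorm q := by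
      intro q
      simp only [eisensteinNorm, eisensteinRotation, Equiv.coe_fn_mk]
      push_cast
      ring
    rw [e (eisensteinRotation p), e p, ← add_mul, ← add_mul]
    simp only [eisensteinStretch, eisensteinRotation, Equiv.coe_fn_mk]
    push_cast
    ring
  have := h3.unique h4
  linarith

/-- The six shortest nonzero vectors of the Eisenstein lattice. -/
def eisensteinUnits : Finset (ℤ × ℤ) := {(1, 0), (-1, 0), (0, 1), (0, -1), (1, -1), (-1, 1)}

/-- The norm is a nonnegative integer and never equals `2`. -/
lemma three_le_eisensteinNorm {p : ℤ × ℤ} (hp : p ∉ eisensteinUnits) (h0 : p ≠ (0, 0)) :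
    3 ≤ eisensteinNorm p := by
  obtain ⟨m, n⟩ := p
  by_contra hlt
  have hlt : m ^ 2 + m * n + n ^ 2 < 3 := by
    have : ((m ^ 2 + m * n + n ^ 2 : ℤ) : ℝ) < ((3 : ℤ) : ℝ) := by
      push_cast
      simpa [eisensteinNorm] using hlt
    exact_mod_cast this
  have hm1 : m < 2 := by nlinarith [sq_nonneg (m + 2 * n)]
  have hm2 : -2 < m := by nlinarith [sq_nonneg (m + 2 * n)]
  have hn1 : n < 2 := by nlinarith [sq_nonneg (2 * m + n)]
  have hn2 : -2 < n := by nlinarith [sq_nonneg (2 * m + n)]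
  interval_cases m <;> interval_cases n <;> simp_all [eisensteinUnits]

lemma tsum_exp_three_tenths_le : ∑' p : ℤ × ℤ, Real.exp (-0.3 * ((p.1 : ℝ) ^ 2 + (p.2 : ℝ) ^ 2)) ≤ 13 := by
  have hs := summable_exp_neg_mul_int_sq (show (0 : ℝ) < 0.3 by norm_num)
  have e3 : Real.exp (-0.3) ≤ 0.742 := by
    rw [Real.exp_neg, inv_le_comm₀ (Real.exp_pos _) (by norm_num)]
    have := one_add_cubic_le_exp (show (0 : ℝ) ≤ 0.3 by norm_num)
    norm_num at this ⊢
    linarith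
  have e9 : Real.exp (-0.9) ≤ 0.409 := by
    have : Real.exp (-0.9) = Real.exp (-0.3) ^ 3 := by rw [← Real.exp_nat_mul]; norm_num
    rw [this]
    calc Real.exp (-0.3) ^ 3 ≤ 0.742 ^ 3 := by gcongr
      _ ≤ 0.409 := by norm_num
  have h1 : ∑' m : ℤ, Real.exp (-0.3 * (m : ℝ) ^ 2) ≤ 3.6 := by
    have h := hs.hasSum.neg.even_lower_bound (c := -Real.exp (-0.3)) (K := Real.exp (-0.3))
      (r := Real.exp (-0.9)) (by intro n; simp) (Real.exp_pos _).le (by linarith) (by simp) (fun n => by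
        rw [neg_le_neg_iff, ← Real.exp_nat_mul, ← Real.exp_add]
        refine Real.exp_le_exp.2 ?_
        push_cast
        have : (0 : ℝ) ≤ n := n.cast_nonneg
        nlinarith [mul_nonneg this this])
    have h5 : Real.exp (-0.9) / (1 - Real.exp (-0.9)) ≤ 0.7 := by
      rw [div_le_iff₀ (by linarith)]; linarith
    have h6 : Real.exp (-0.3) * (Real.exp (-0.9) / (1 - Real.exp (-0.9))) ≤ 0.742 * 0.7 :=
      mul_le_mul e3 h5 (div_nonneg (Real.exp_pos _).le (by linarith)) (by norm_num)
    simp at h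
    norm_num at h h6 e3 ⊢
    linarith
  have h0 : 0 ≤ ∑' m : ℤ, Real.exp (-0.3 * (m : ℝ) ^ 2) := tsum_nonneg fun _ => (Real.exp_pos _).le
  have h2 : ∑' p : ℤ × ℤ, Real.exp (-0.3 * ((p.1 : ℝ) ^ 2 + (p.2 : ℝ) ^ 2)) =
      (∑' m : ℤ, Real.exp (-0.3 * (m : ℝ) ^ 2)) * ∑' m : ℤ, Real.exp (-0.3 * (m : ℝ) ^ 2) := by
    rw [hs.tsum_mul_tsum hs (hs.mul_of_nonneg hs (fun _ => (Real.exp_pos _).le) (fun _ => (Real.exp_pos _).le))]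
    refine tsum_congr fun p => ?_
    rw [← Real.exp_add]
    ring_nf
  rw [h2]
  nlinarith

/-- Prepares the sum over long vectors: with `S = m² + n²`, the right side sums over the lattice to
at most `13 · 0.0144 exp (-c) < 0.2 exp (-c)`. The exponent `5.4` is exact for `c = 3.6`, `N = 3`,
`S = 6`. -/
lemma eisensteinNorm_mul_exp_le {c N S : ℝ} (hc : 3.6 ≤ c) (hN : 3 ≤ N) (hS : S / 2 ≤ N) :
    N * Real.exp (-c * N) ≤ Real.exp (-c) * (0.0144 * Real.exp (-0.3 * S)) := by
  have h1 := Real.add_one_le_exp ((N - 3) / 3)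
  have e54 : Real.exp (-5.4) ≤ 0.0048 := by
    rw [Real.exp_neg, inv_le_comm₀ (Real.exp_pos _) (by norm_num)]
    have h1 := Real.exp_one_gt_d9
    have h3 := one_add_cubic_le_exp (show (0 : ℝ) ≤ 0.4 by norm_num)
    calc ((0.0048 : ℝ)⁻¹) ≤ 2.718 ^ 5 * (1 + 0.4 + 0.4 ^ 2 / 2 + 0.4 ^ 3 / 6) := by norm_num
      _ ≤ Real.exp 1 ^ 5 * Real.exp 0.4 := by gcongr; linarith
      _ = Real.exp 5.4 := by rw [← Real.exp_nat_mul, ← Real.exp_add]; norm_num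
  calc N * Real.exp (-c * N) ≤ (3 * Real.exp ((N - 3) / 3)) * Real.exp (-c * N) := by
        gcongr; linarith
    _ = 3 * Real.exp ((N - 3) / 3 - c * N) := by rw [mul_assoc, ← Real.exp_add]; ring_nf
    _ ≤ 3 * Real.exp (-c + (-5.4 + -0.3 * S)) := by
        gcongr
        nlinarith
    _ = 3 * (Real.exp (-c) * (Real.exp (-5.4) * Real.exp (-0.3 * S))) := by
        rw [Real.exp_add, Real.exp_add]
    _ ≤ 3 * (Real.exp (-c) * (0.0048 * Real.exp (-0.3 * S))) := by gcongr
    _ = _ := by ring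

/-- To second order the right side is `24 v² - 4 k ≥ 4 v²`; cubic Taylor bounds show that the
remainder is nonnegative. -/
lemma six_units_gain_of_small {v k : ℝ} (hv : 0 ≤ v) (hv3 : v ≤ 0.3) (hk : k ≤ 5 * v ^ 2) :
    4 * v ^ 2 ≤ 2 * (Real.exp (4 * v) - 1 - 4 * v) + 4 * (Real.exp (-(2 * v) - k) - 1 + 2 * v) := by
  have h1 := one_add_cubic_le_exp (show 0 ≤ 4 * v by positivity)
  have h2 := cubic_le_exp_neg (show 0 ≤ 2 * v + 5 * v ^ 2 by positivity)
  have h3 : Real.exp (-(2 * v + 5 * v ^ 2)) ≤ Real.exp (-(2 * v) - k) := Real.exp_le_exp.2 (by linarith)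
  have h4 : 0 ≤ 56 + 10 * v - 100 * v ^ 2 - 84 * v ^ 3 := by
    have : v ^ 2 ≤ 0.3 ^ 2 := by gcongr
    have : v ^ 3 ≤ 0.3 ^ 3 := by gcongr
    norm_num at *
    linarith
  have h5 := mul_nonneg (pow_nonneg hv 3) h4
  nlinarith [pow_nonneg hv 6]

lemma six_units_gain_of_large {v k : ℝ} (hv3 : 0.3 ≤ v) :
    0.2 * (1 / 3 + 4 * v) <
      2 * (Real.exp (4 * v) - 1 - 4 * v) + 4 * (Real.exp (-(2 * v) - k) - 1 + 2 * v) := by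
  have h1 := one_add_cubic_le_exp (show 0 ≤ 4 * v - 1.2 by linarith)
  have h2 : Real.exp (4 * v) = Real.exp 1.2 * Real.exp (4 * v - 1.2) := by
    rw [← Real.exp_add]; ring_nf
  have h3 : 3.3 ≤ Real.exp 1.2 := by
    have h4 : Real.exp 1.2 = Real.exp 1 * Real.exp 0.2 := by rw [← Real.exp_add]; norm_num
    have h5 := Real.exp_one_gt_d9
    have h6 := one_add_cubic_le_exp (show (0 : ℝ) ≤ 0.2 by norm_num)
    rw [h4]
    norm_num at h6
    nlinarith
  have h7 := Real.exp_pos (-(2 * v) - k)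
  have h8 : 1 + (4 * v - 1.2) ≤ Real.exp (4 * v - 1.2) := by linarith [Real.add_one_le_exp (4 * v - 1.2)]
  rw [h2]
  have h9 : 3.3 * (1 + (4 * v - 1.2)) ≤ Real.exp 1.2 * Real.exp (4 * v - 1.2) :=
    mul_le_mul h3 h8 (by linarith) (by linarith)
  linarith

/-- Stretching the triangular lattice along a basis vector increases its theta function. -/
lemma tsum_exp_eisensteinNorm_lt {b p : ℝ} (hb : 0.905 ≤ b) (hp : 0 < p) (hpb : p < b)
    (hs : Summable fun q : ℤ × ℤ =>
      Real.exp (-(p * (2 * q.1 + q.2) ^ 2 + 3 * b ^ 2 / p * (q.2 : ℝ) ^ 2))) :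
    ∑' q : ℤ × ℤ, Real.exp (-(4 * b) * eisensteinNorm q) <
      ∑' q : ℤ × ℤ, Real.exp (-(p * (2 * q.1 + q.2) ^ 2 + 3 * b ^ 2 / p * (q.2 : ℝ) ^ 2)) := by
  obtain ⟨v, rfl⟩ : ∃ v, p = b - v := ⟨b - p, by ring⟩
  have hv : 0 < v := by linarith
  obtain ⟨k, hk⟩ : ∃ k, k = 3 * v ^ 2 / (b - v) := ⟨_, rfl⟩
  have hk0 : 0 ≤ k := by rw [hk]; positivity
  have hq : 3 * b ^ 2 / (b - v) = 3 * b + 3 * v + k := by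
    rw [hk]; field_simp; ring
  have hc : 0 < 4 * b := by linarith
  have hterm : ∀ q : ℤ × ℤ,
      Real.exp (-((b - v) * (2 * q.1 + q.2) ^ 2 + 3 * b ^ 2 / (b - v) * (q.2 : ℝ) ^ 2)) =
      Real.exp (-(4 * b) * eisensteinNorm q) *
        Real.exp (2 * v * eisensteinStretch q - k * (q.2 : ℝ) ^ 2) := by
    intro q
    rw [← Real.exp_add, hq]
    unfold eisensteinNorm eisensteinStretch
    ring_nf
  have hE := summable_exp_eisensteinNorm hc
  have hW := summable_eisensteinStretch_mul_exp hc
  set t : ℤ × ℤ → ℝ := fun q => Real.exp (-(4 * b) * eisensteinNorm q) *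
    (Real.exp (2 * v * eisensteinStretch q - k * (q.2 : ℝ) ^ 2) - 1 - 2 * v * eisensteinStretch q) with ht
  -- Subtracting the first-order term costs nothing, since it sums to zero at the critical point.
  have htsum : HasSum t (∑' q : ℤ × ℤ,
      Real.exp (-((b - v) * (2 * q.1 + q.2) ^ 2 + 3 * b ^ 2 / (b - v) * (q.2 : ℝ) ^ 2)) -
      ∑' q : ℤ × ℤ, Real.exp (-(4 * b) * eisensteinNorm q)) := by
    have h := (hs.hasSum.sub hE.hasSum).sub (hW.hasSum.mul_left (2 * v))
    rw [tsum_eisensteinStretch_mul_exp hc, mul_zero, sub_zero] at h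
    refine Eq.mp (congrArg (fun g => HasSum g _) (funext fun q => ?_)) h
    rw [hterm, ht]
    ring
  rw [← sub_pos]
  have hG := summable_exp_neg_mul_sq_add_sq (show (0 : ℝ) < 0.3 by norm_num)
  -- it suffices to bound the terms of norm at least three from below by a multiple of the norm
  have main : ∀ M : ℝ, 0 ≤ M → (∀ q : ℤ × ℤ, 3 ≤ eisensteinNorm q →
      -(M * eisensteinNorm q) ≤ Real.exp (2 * v * eisensteinStretch q - k * (q.2 : ℝ) ^ 2) - 1 -
        2 * v * eisensteinStretch q) →
      0.2 * M < 2 * (Real.exp (4 * v) - 1 - 4 * v) + 4 * (Real.exp (-(2 * v) - k) - 1 + 2 * v) →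
      0 < ∑' q : ℤ × ℤ,
        Real.exp (-((b - v) * (2 * q.1 + q.2) ^ 2 + 3 * b ^ 2 / (b - v) * (q.2 : ℝ) ^ 2)) -
        ∑' q : ℤ × ℤ, Real.exp (-(4 * b) * eisensteinNorm q) := by
    intro M hM hlow hgain
    have hadd := htsum.add (hG.hasSum.mul_left (M * (Real.exp (-(4 * b)) * 0.0144)))
    have hle := sum_le_hasSum eisensteinUnits (fun q hq => ?_) hadd
    · have hF : Real.exp (-(4 * b)) * (2 * (Real.exp (4 * v) - 1 - 4 * v) +
          4 * (Real.exp (-(2 * v) - k) - 1 + 2 * v)) ≤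
          ∑ q ∈ eisensteinUnits, (t q + M * (Real.exp (-(4 * b)) * 0.0144) *
            Real.exp (-0.3 * ((q.1 : ℝ) ^ 2 + (q.2 : ℝ) ^ 2))) := by
        have h1 : ∑ q ∈ eisensteinUnits, t q = Real.exp (-(4 * b)) *
            (2 * (Real.exp (4 * v) - 1 - 4 * v) + 4 * (Real.exp (-(2 * v) - k) - 1 + 2 * v)) := by
          simp [eisensteinUnits, ht, eisensteinNorm, eisensteinStretch]
          ring_nf
        rw [← h1]
        refine Finset.sum_le_sum fun q _ => ?_
        have : 0 ≤ M * (Real.exp (-(4 * b)) * 0.0144) *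
            Real.exp (-0.3 * ((q.1 : ℝ) ^ 2 + (q.2 : ℝ) ^ 2)) := by positivity
        linarith
      have h2 := mul_le_mul_of_nonneg_left tsum_exp_three_tenths_le
        (show 0 ≤ M * (Real.exp (-(4 * b)) * 0.0144) by positivity)
      have h3 := mul_lt_mul_of_pos_left hgain (Real.exp_pos (-(4 * b)))
      have h4 : 0 ≤ M * Real.exp (-(4 * b)) := by positivity
      linarith
    · rcases eq_or_ne q (0, 0) with rfl | h0
      · have : t (0, 0) = 0 := by simp [ht, eisensteinStretch]
        rw [this, zero_add]
        positivity
      · have h3 := three_le_eisensteinNorm hq h0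
        have h4 := mul_le_mul_of_nonneg_left (hlow q h3) (Real.exp_pos (-(4 * b) * eisensteinNorm q)).le
        have h5 := mul_le_mul_of_nonneg_left (eisensteinNorm_mul_exp_le (show 3.6 ≤ 4 * b by linarith) h3
          (sq_add_sq_le_eisensteinNorm q)) hM
        simp only [ht]
        linarith
  -- For small `v`, `exp u ≥ 1 + u` leaves a loss of at most `k n²`, quadratic in `v`. For larger
  -- `v`, `exp u > 0` leaves a loss linear in the norm.
  rcases le_total v 0.3 with h | h
  -- Here `b - v ≥ 0.605`, and `3 / 0.605 < 5`.
  · have hk5 : k ≤ 5 * v ^ 2 := by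
      rw [hk, div_le_iff₀ hp]
      nlinarith [sq_nonneg v]
    refine main (4 / 3 * k) (by positivity) (fun q _ => ?_) ?_
    · have h1 := Real.add_one_le_exp (2 * v * eisensteinStretch q - k * (q.2 : ℝ) ^ 2)
      have h2 : (q.2 : ℝ) ^ 2 ≤ 4 / 3 * eisensteinNorm q := by
        unfold eisensteinNorm
        nlinarith [sq_nonneg (2 * (q.1 : ℝ) + q.2)]
      have h3 := mul_le_mul_of_nonneg_left h2 hk0
      linarith
    · have := six_units_gain_of_small hv.le h hk5
      have : 0 < v ^ 2 := by positivity
      linarith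
  · refine main (1 / 3 + 4 * v) (by positivity) (fun q hq => ?_) (six_units_gain_of_large h)
    have h1 := Real.exp_pos (2 * v * eisensteinStretch q - k * (q.2 : ℝ) ^ 2)
    have h2 := mul_le_mul_of_nonneg_left (le_of_abs_le (abs_eisensteinStretch_le q)) (show 0 ≤ 2 * v by linarith)
    have h3 : eisensteinStretch q ≤ 2 * eisensteinNorm q := by
      unfold eisensteinNorm eisensteinStretch
      nlinarith [sq_nonneg (q.2 : ℝ)]
    nlinarith

open Real in
lemma quadTheta_triangular_lt_of_half {α y : ℝ} (hα : 1 ≤ α) (hy : √3 / 2 < y) :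
    quadTheta α (1 / 2) (√3 / 2) < quadTheta α (1 / 2) y := by
  have hα0 : 0 < α := by linarith
  have h3 : 0 < √3 := by positivity
  have h33 : √3 ^ 2 = 3 := Real.sq_sqrt (by norm_num)
  have hy0 : 0 < y := by linarith [div_pos h3 two_pos]
  have h3lt : √3 < 1.7321 := by rw [Real.sqrt_lt' (by norm_num)]; norm_num
  -- At `α = 1` the right side is `0.9068…`; this is where `α ≥ 1` enters.
  have hb : 0.905 ≤ π * α / (2 * √3) := by
    rw [le_div_iff₀ (by positivity)]
    nlinarith [pi_gt_d2]
  have hpb : π * α / (4 * y) < π * α / (2 * √3) :=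
    div_lt_div_of_pos_left (by positivity) (by positivity) (by linarith)
  have e1 : quadTheta α (1 / 2) (√3 / 2) =
      ∑' q : ℤ × ℤ, Real.exp (-(4 * (π * α / (2 * √3))) * eisensteinNorm q) := by
    refine tsum_congr fun q => ?_
    congr 1
    unfold eisensteinNorm
    field_simp
    rw [h33]
    ring
  have e2 : ∀ q : ℤ × ℤ, Real.exp (-π * α * (((q.1 : ℝ) + q.2 * (1 / 2)) ^ 2 + q.2 ^ 2 * y ^ 2) / y) =
      Real.exp (-(π * α / (4 * y) * (2 * q.1 + q.2) ^ 2 +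
        3 * (π * α / (2 * √3)) ^ 2 / (π * α / (4 * y)) * (q.2 : ℝ) ^ 2)) := by
    intro q
    congr 1
    have : 3 * (π * α / (2 * √3)) ^ 2 / (π * α / (4 * y)) = π * α * y := by
      field_simp
      rw [h33]
      ring
    rw [this]
    field_simp
    ring
  rw [e1]
  refine (tsum_exp_eisensteinNorm_lt hb (by positivity) hpb ?_).trans_eq (tsum_congr e2).symm
  exact (summable_quadTheta hα0 (1 / 2) hy0).congr e2

/-- Montgomery's theorem: among reduced shapes the triangular one has the smallest theta function. -/
theorem quadTheta_triangular_lt {α x y : ℝ} (hα : 0 < α) (hx : 0 ≤ x) (hx2 : x ≤ 1 / 2) (hy : 0 < y)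
    (hxy : 1 ≤ x ^ 2 + y ^ 2) (hne : ¬(x = 1 / 2 ∧ y = √3 / 2)) :
    quadTheta α (1 / 2) (√3 / 2) < quadTheta α x y := by
  have h3 : 0 < √3 := by positivity
  have h33 : √3 ^ 2 = 3 := Real.sq_sqrt (by norm_num)
  have hy3 : √3 / 2 ≤ y := by
    have : (√3 / 2) ^ 2 ≤ y ^ 2 := by
      rw [div_pow, h33]; nlinarith
    exact le_of_sq_le_sq this hy.le
  have key : ∀ β : ℝ, 1 ≤ β → quadTheta β (1 / 2) (√3 / 2) < quadTheta β x y := by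
    intro β hβ
    rcases hx2.lt_or_eq with hlt | rfl
    · refine lt_of_le_of_lt ?_ (quadTheta_half_lt hβ hx hlt hy hxy)
      rcases hy3.lt_or_eq with h | rfl
      · exact (quadTheta_triangular_lt_of_half hβ h).le
      · exact le_rfl
    · refine quadTheta_triangular_lt_of_half hβ (lt_of_le_of_ne hy3 fun h => hne ⟨rfl, h.symm⟩)
  rcases le_total 1 α with h | h
  · exact key α h
  · have h1 := key α⁻¹ (one_le_inv₀ hα |>.2 h)
    rw [quadTheta_inv hα _ hy, quadTheta_inv hα _ (by positivity)] at h1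
    exact lt_of_mul_lt_mul_left h1 hα.le

/-! ### Shapes of bases, reduction, covolume. -/

/-- The pair `u₀, u₁` spans a parallelogram of area `A` and is similar to `1, x + i y`. -/
def HasShape (A x y : ℝ) (u₀ u₁ : Plane) : Prop :=
  ∀ m n : ℝ, ‖m • u₀ + n • u₁‖ ^ 2 = A * ((m + n * x) ^ 2 + n ^ 2 * y ^ 2) / y

/-- The lattice generated by two vectors. -/
def pairLattice (u₀ u₁ : Plane) : Submodule ℤ Plane := Submodule.span ℤ {u₀, u₁}

lemma mem_pairLattice {u₀ u₁ x : Plane} :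
    x ∈ pairLattice u₀ u₁ ↔ ∃ m n : ℤ, (m : ℝ) • u₀ + (n : ℝ) • u₁ = x := by
  rw [pairLattice, Submodule.mem_span_pair]
  simp only [Int.cast_smul_eq_zsmul]

lemma norm_sq_smul_add_smul (m n : ℝ) (u₀ u₁ : Plane) :
    ‖m • u₀ + n • u₁‖ ^ 2 = m ^ 2 * ‖u₀‖ ^ 2 + 2 * m * n * inner ℝ u₀ u₁ + n ^ 2 * ‖u₁‖ ^ 2 := by
  rw [norm_add_sq_real, norm_smul, norm_smul, inner_smul_left, inner_smul_right, mul_pow, mul_pow,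
    Real.norm_eq_abs, Real.norm_eq_abs, sq_abs, sq_abs]
  simp
  ring

lemma HasShape.linearIndependent {A x y : ℝ} {u₀ u₁ : Plane} (h : HasShape A x y u₀ u₁)
    (hA : 0 < A) (hy : 0 < y) : LinearIndependent ℝ ![u₀, u₁] := by
  rw [LinearIndependent.pair_iff]
  intro m n hmn
  have h1 := h m n
  rw [hmn, norm_zero, eq_comm, div_eq_iff hy.ne'] at h1
  have h2 : (m + n * x) ^ 2 + n ^ 2 * y ^ 2 = 0 := by
    have : A * ((m + n * x) ^ 2 + n ^ 2 * y ^ 2) = 0 := by linarith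
    exact (mul_eq_zero.1 this).resolve_left hA.ne'
  have hn : n ^ 2 * y ^ 2 = 0 := by nlinarith [sq_nonneg (m + n * x), sq_nonneg (n * y)]
  have hn : n = 0 := by
    rcases mul_eq_zero.1 hn with h | h
    · exact pow_eq_zero_iff two_ne_zero |>.1 h
    · exact absurd h (by positivity)
  subst hn
  simpa using h2

lemma exists_hasShape {u₀ u₁ : Plane} (h : LinearIndependent ℝ ![u₀, u₁]) :
    ∃ A x y : ℝ, 0 < A ∧ 0 < y ∧ HasShape A x y u₀ u₁ := by
  have h0 : u₀ ≠ 0 := h.ne_zero 0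
  have ha : 0 < ‖u₀‖ ^ 2 := by positivity
  set a := ‖u₀‖ ^ 2 with ha'
  set b := inner ℝ u₀ u₁ with hb'
  set c := ‖u₁‖ ^ 2 with hc'
  have hD : 0 < a * c - b ^ 2 := by
    -- This vector is orthogonal to `u₀`, and its squared norm is `a` times the Gram determinant.
    have h1 : (-b) • u₀ + a • u₁ ≠ 0 := by
      intro h2
      exact ha.ne' (LinearIndependent.pair_iff.1 h _ _ h2).2
    have h2 : 0 < ‖(-b) • u₀ + a • u₁‖ ^ 2 := by positivity
    rw [norm_sq_smul_add_smul, ← ha', ← hb', ← hc'] at h2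
    have h3 : 0 < a * (a * c - b ^ 2) := by linarith
    exact pos_of_mul_pos_right h3 ha.le
  have hs := Real.sqrt_pos.2 hD
  have hs2 := Real.sq_sqrt hD.le
  refine ⟨√(a * c - b ^ 2), b / a, √(a * c - b ^ 2) / a, hs, by positivity, fun m n => ?_⟩
  rw [norm_sq_smul_add_smul, ← ha', ← hb', ← hc', div_pow, hs2]
  field_simp
  ring

lemma HasShape.neg_right {A x y : ℝ} {u₀ u₁ : Plane} (h : HasShape A x y u₀ u₁) :
    HasShape A (-x) y u₀ (-u₁) := by
  intro m n
  have := h m (-n)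
  rw [smul_neg, ← neg_smul, this]
  ring

lemma pairLattice_neg_right (u₀ u₁ : Plane) : pairLattice u₀ (-u₁) = pairLattice u₀ u₁ := by
  ext x
  simp only [mem_pairLattice]
  constructor <;> rintro ⟨m, n, rfl⟩ <;> exact ⟨m, -n, by simp⟩

lemma pairLattice_comm (u₀ u₁ : Plane) : pairLattice u₀ u₁ = pairLattice u₁ u₀ := by
  rw [pairLattice, pairLattice, Set.pair_comm]

open UpperHalfPlane Modular in
/-- Every plane lattice has a reduced basis. -/
lemma exists_reduced_hasShape {u₀ u₁ : Plane} (h : LinearIndependent ℝ ![u₀, u₁]) :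
    ∃ (A x y : ℝ) (w₀ w₁ : Plane), 0 < A ∧ 0 ≤ x ∧ x ≤ 1 / 2 ∧ 0 < y ∧ 1 ≤ x ^ 2 + y ^ 2 ∧
      HasShape A x y w₀ w₁ ∧ pairLattice w₀ w₁ = pairLattice u₀ u₁ := by
  obtain ⟨A, x, y, hA, hy, hu⟩ := exists_hasShape h
  have hz : ∀ m n : ℝ, (m + n * x) ^ 2 + n ^ 2 * y ^ 2 = Complex.normSq (m + n * (⟨x, y⟩ : ℂ)) := by
    intro m n
    simp [Complex.normSq_apply]
    ring
  obtain ⟨g, hg⟩ := ModularGroup.exists_smul_mem_fd (⟨⟨x, y⟩, hy⟩ : ℍ)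
  have hgz := UpperHalfPlane.coe_specialLinearGroup_apply g (⟨⟨x, y⟩, hy⟩ : ℍ)
  have him := ModularGroup.im_smul_eq_div_normSq g (⟨⟨x, y⟩, hy⟩ : ℍ)
  rw [ModularGroup.denom_apply] at him
  have hden : ((g 1 0 : ℤ) : ℂ) * (⟨x, y⟩ : ℂ) + ((g 1 1 : ℤ) : ℂ) ≠ 0 := by
    have := UpperHalfPlane.denom_ne_zero (g : GL (Fin 2) ℝ) (⟨⟨x, y⟩, hy⟩ : ℍ)
    rwa [ModularGroup.denom_apply] at this
  have hdet : g 0 0 * g 1 1 - g 0 1 * g 1 0 = 1 := by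
    have := g.det_coe
    rwa [Matrix.det_fin_two] at this
  generalize hw : g • (⟨⟨x, y⟩, hy⟩ : ℍ) = w at *
  simp only [algebraMap_int_eq, eq_intCast, Complex.ofReal_intCast] at hgz
  generalize g 0 0 = p at *
  generalize g 0 1 = q at *
  generalize g 1 0 = r at *
  generalize g 1 1 = s at *
  -- The new basis corresponds to `r z + s` and `p z + q`, whose quotient is `w = g • z`. The area
  -- is kept because `Im w = Im z / |r z + s|²`.
  have hs : HasShape A w.re w.im ((s : ℝ) • u₀ + (r : ℝ) • u₁) ((q : ℝ) • u₀ + (p : ℝ) • u₁) := by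
    intro m n
    have e1 : m • ((s : ℝ) • u₀ + (r : ℝ) • u₁) + n • ((q : ℝ) • u₀ + (p : ℝ) • u₁) =
        (m * s + n * q) • u₀ + (m * r + n * p) • u₁ := by
      simp only [smul_add, add_smul, mul_smul]
      abel
    have e2 : (m + n * w.re) ^ 2 + n ^ 2 * w.im ^ 2 = Complex.normSq (m + n * (w : ℂ)) := by
      simp [Complex.normSq_apply]
      ring
    have e3 : (((m * s + n * q : ℝ) : ℂ) + ((m * r + n * p : ℝ) : ℂ) * (⟨x, y⟩ : ℂ)) =
        (r * (⟨x, y⟩ : ℂ) + s) * (m + n * (w : ℂ)) := by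
      rw [eq_div_iff hden] at hgz
      push_cast
      linear_combination (-(n : ℂ)) * hgz
    rw [e1, hu, hz, e2, e3, Complex.normSq_mul, him]
    have h0 : Complex.normSq (r * (⟨x, y⟩ : ℂ) + s) ≠ 0 := by simpa using hden
    have h1 : ((⟨⟨x, y⟩, hy⟩ : ℍ)).im = y := rfl
    simp only [h1]
    change _ = A * _ / (y / Complex.normSq (r * (⟨x, y⟩ : ℂ) + s))
    field_simp
  have hL : pairLattice ((s : ℝ) • u₀ + (r : ℝ) • u₁) ((q : ℝ) • u₀ + (p : ℝ) • u₁) = pairLattice u₀ u₁ := by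
    have hdet' : (p : ℝ) * s - q * r = 1 := by exact_mod_cast hdet
    ext v
    simp only [mem_pairLattice]
    constructor
    · rintro ⟨m, n, rfl⟩
      refine ⟨m * s + n * q, m * r + n * p, ?_⟩
      push_cast
      module
    · rintro ⟨m, n, rfl⟩
      refine ⟨m * p - n * q, n * s - m * r, ?_⟩
      push_cast
      have e : ((m : ℝ) * p - n * q) • ((s : ℝ) • u₀ + (r : ℝ) • u₁) +
          ((n : ℝ) * s - m * r) • ((q : ℝ) • u₀ + (p : ℝ) • u₁) =
          (m * ((p : ℝ) * s - q * r)) • u₀ + (n * ((p : ℝ) * s - q * r)) • u₁ := by module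
      rw [e, hdet', mul_one, mul_one]
  have hfd1 : 1 ≤ w.re ^ 2 + w.im ^ 2 := by
    have := hg.1
    rw [Complex.normSq_apply] at this
    simpa [sq] using this
  have hfd2 : |w.re| ≤ 1 / 2 := hg.2
  -- Replacing the second vector by its negative changes `x` to `-x` and keeps the lattice.
  rcases le_total 0 w.re with h0 | h0
  · exact ⟨A, w.re, w.im, _, _, hA, h0, (le_abs_self _).trans hfd2, w.im_pos, hfd1, hs, hL⟩
  · exact ⟨A, -w.re, w.im, _, _, hA, by linarith, (neg_le_abs _).trans hfd2, w.im_pos, by simpa using hfd1,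
      hs.neg_right, (pairLattice_neg_right _ _).trans hL⟩

/-- The signed area of the parallelogram spanned by two vectors of the plane. -/
noncomputable def signedArea (u₀ u₁ : Plane) : ℝ := u₀ 0 * u₁ 1 - u₀ 1 * u₁ 0

lemma basisFun_det_eq_signedArea (u : Fin 2 → Plane) :
    (EuclideanSpace.basisFun (Fin 2) ℝ).toBasis.det u = signedArea (u 0) (u 1) := by
  rw [Module.Basis.det_apply, Matrix.det_fin_two]
  simp [Module.Basis.toMatrix_apply, signedArea]
  ring

lemma HasShape.signedArea_sq {A x y : ℝ} {u₀ u₁ : Plane} (h : HasShape A x y u₀ u₁) (hy : 0 < y) :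
    signedArea u₀ u₁ ^ 2 = A ^ 2 := by
  have h0 := h 1 0
  have h1 := h 0 1
  have h2 := h 1 1
  simp [EuclideanSpace.norm_sq_eq, Fin.sum_univ_two] at h0 h1 h2
  have hb : u₀ 0 * u₁ 0 + u₀ 1 * u₁ 1 = A * x / y := by
    have : A * ((1 + x) ^ 2 + y ^ 2) / y = A / y + A * (x ^ 2 + y ^ 2) / y + 2 * (A * x / y) := by
      field_simp; ring
    rw [this] at h2
    linarith
  have e : signedArea u₀ u₁ ^ 2 = (u₀ 0 ^ 2 + u₀ 1 ^ 2) * (u₁ 0 ^ 2 + u₁ 1 ^ 2) -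
      (u₀ 0 * u₁ 0 + u₀ 1 * u₁ 1) ^ 2 := by
    unfold signedArea; ring
  rw [e, h0, h1, hb]
  field_simp
  ring

lemma signedArea_comm (u₀ u₁ : Plane) : signedArea u₁ u₀ = -signedArea u₀ u₁ := by
  unfold signedArea; ring

lemma range_pair (u₀ u₁ : Plane) : range ![u₀, u₁] = {u₀, u₁} := by
  rw [Matrix.range_cons_cons_empty]

/-- The real basis of the plane given by two independent vectors. -/
noncomputable def pairBasis {u₀ u₁ : Plane} (h : LinearIndependent ℝ ![u₀, u₁]) :
    Module.Basis (Fin 2) ℝ Plane :=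
  basisOfLinearIndependentOfCardEqFinrank h (by simp)

@[simp]
lemma coe_pairBasis {u₀ u₁ : Plane} (h : LinearIndependent ℝ ![u₀, u₁]) : ⇑(pairBasis h) = ![u₀, u₁] := by
  simp [pairBasis]

lemma pairLattice_eq_span_pairBasis {u₀ u₁ : Plane} (h : LinearIndependent ℝ ![u₀, u₁]) :
    pairLattice u₀ u₁ = Submodule.span ℤ (range (pairBasis h)) := by
  rw [coe_pairBasis, range_pair, pairLattice]

lemma HasShape.covolume {A x y : ℝ} {u₀ u₁ : Plane} (h : HasShape A x y u₀ u₁) (hA : 0 < A)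
    (hy : 0 < y) : ZLattice.covolume (pairLattice u₀ u₁) = A := by
  have hli := h.linearIndependent hA hy
  rw [pairLattice_eq_span_pairBasis hli,
    ZLattice.covolume_eq_measure_fundamentalDomain _ _ (ZSpan.isAddFundamentalDomain (pairBasis hli) volume),
    ZSpan.measureReal_fundamentalDomain _ _ (EuclideanSpace.basisFun (Fin 2) ℝ).toBasis,
    basisFun_det_eq_signedArea, coe_pairBasis]
  have h1 : volume.real (ZSpan.fundamentalDomain (EuclideanSpace.basisFun (Fin 2) ℝ).toBasis) = 1 := by
    rw [measureReal_def, measure_congr (ZSpan.fundamentalDomain_ae_parallelepiped _ volume)]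
    have := (EuclideanSpace.basisFun (Fin 2) ℝ).volume_parallelepiped
    simpa using congrArg ENNReal.toReal this
  rw [h1, mul_one]
  have := h.signedArea_sq hy
  simp only [Matrix.cons_val_zero, Matrix.cons_val_one]
  rwa [← sq_eq_sq₀ (abs_nonneg _) hA.le, sq_abs]

lemma IsBravaisLattice.exists_pair {L : Submodule ℤ Plane} (h : IsBravaisLattice L) :
    ∃ u₀ u₁ : Plane, LinearIndependent ℝ ![u₀, u₁] ∧ L = pairLattice u₀ u₁ := by
  obtain ⟨u, hu, rfl⟩ := h
  have e : u = ![u 0, u 1] := by ext i; fin_cases i <;> rfl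
  refine ⟨u 0, u 1, e ▸ hu, ?_⟩
  rw [pairLattice, ← range_pair, ← e]

lemma isBravaisLattice_pairLattice {u₀ u₁ : Plane} (h : LinearIndependent ℝ ![u₀, u₁]) :
    IsBravaisLattice (pairLattice u₀ u₁) :=
  ⟨_, h, by rw [pairLattice, range_pair]⟩

/-! ### Theta series of lattices, and rotations. -/

/-- The theta series of a lattice without the term of the origin. -/
noncomputable def latticeTheta (τ : ℝ) (L : Submodule ℤ Plane) : ℝ≥0∞ :=
  ∑' x : {x : Plane // x ∈ L ∧ x ≠ 0}, ENNReal.ofReal (Real.exp (-τ * ‖(x : Plane)‖ ^ 2))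

lemma HasShape.one_add_latticeTheta {A x y τ : ℝ} {u₀ u₁ : Plane} (h : HasShape A x y u₀ u₁)
    (hA : 0 < A) (hy : 0 < y) (hτ : 0 < τ) :
    1 + latticeTheta τ (pairLattice u₀ u₁) = ENNReal.ofReal (quadTheta (τ * A / Real.pi) x y) := by
  have hli := LinearIndependent.pair_iff.1 (h.linearIndependent hA hy)
  set F : Plane → ℝ≥0∞ := fun v => ENNReal.ofReal (Real.exp (-τ * ‖v‖ ^ 2)) with hF
  set φ : ℤ × ℤ → Plane := fun p => (p.1 : ℝ) • u₀ + (p.2 : ℝ) • u₁ with hφ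
  have hinj : Function.Injective φ := by
    intro p q hpq
    have h1 : ((p.1 : ℝ) - q.1) • u₀ + ((p.2 : ℝ) - q.2) • u₁ = 0 := by
      have : φ p - φ q = 0 := sub_eq_zero.2 hpq
      rw [← this, hφ]
      module
    obtain ⟨h2, h3⟩ := hli _ _ h1
    ext
    · exact_mod_cast sub_eq_zero.1 h2
    · exact_mod_cast sub_eq_zero.1 h3
  have hcoe : (pairLattice u₀ u₁ : Set Plane) = range φ := by
    ext v
    rw [SetLike.mem_coe, mem_pairLattice]
    simp [hφ]
  have h1 : latticeTheta τ (pairLattice u₀ u₁) =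
      ∑' v : Plane, {v | v ∈ pairLattice u₀ u₁ ∧ v ≠ 0}.indicator F v :=
    tsum_subtype {v | v ∈ pairLattice u₀ u₁ ∧ v ≠ 0} F
  have h2 : ∑' v : Plane, ({0} : Set Plane).indicator F v = 1 := by
    rw [← tsum_subtype, tsum_singleton (0 : Plane) F]
    simp [hF]
  have h3 : ∑' p, F (φ p) = ∑' v : Plane, (pairLattice u₀ u₁ : Set Plane).indicator F v := by
    rw [← hinj.tsum_eq (f := (pairLattice u₀ u₁ : Set Plane).indicator F)
      (fun v hv => hcoe ▸ Set.mem_of_indicator_ne_zero hv)]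
    refine tsum_congr fun p => ?_
    rw [Set.indicator_of_mem]
    rw [hcoe]
    exact mem_range_self p
  rw [h1, ← h2, ← ENNReal.tsum_add, quadTheta, ENNReal.ofReal_tsum_of_nonneg (fun _ => (Real.exp_pos _).le)
    (summable_quadTheta (by have := Real.pi_pos; positivity) x hy)]
  trans ∑' p, F (φ p)
  · rw [h3]
    refine tsum_congr fun v => ?_
    by_cases hv : v = 0
    · subst hv
      simp
    · by_cases hvL : v ∈ pairLattice u₀ u₁ <;> simp [hv, hvL]
  · refine tsum_congr fun p => ?_
    simp only [hF, hφ]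
    rw [h]
    congr 2
    have := Real.pi_pos
    field_simp

lemma latticeTheta_eq_of_isRotationOf {L M : Submodule ℤ Plane} (h : IsRotationOf L M) (τ : ℝ) :
    latticeTheta τ L = latticeTheta τ M := by
  obtain ⟨R, -, hR⟩ := h
  have hmem : ∀ x, x ∈ M ↔ R x ∈ L := by
    intro x
    rw [← SetLike.mem_coe (p := L), hR]
    simp
  let e : {x : Plane // x ∈ M ∧ x ≠ 0} ≃ {x : Plane // x ∈ L ∧ x ≠ 0} :=
    R.toEquiv.subtypeEquiv fun x => by simp [hmem]
  unfold latticeTheta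
  rw [← e.tsum_eq]
  refine tsum_congr fun x => ?_
  have : ((e x : {x : Plane // x ∈ L ∧ x ≠ 0}) : Plane) = R x := rfl
  rw [this, R.norm_map]

/-- The linear map between the bases is an isometry since the shape determines all norms, and equal
signed areas force determinant `1`. -/
lemma exists_rotation {A x y : ℝ} {u₀ u₁ v₀ v₁ : Plane} (hA : 0 < A) (hy : 0 < y)
    (hu : HasShape A x y u₀ u₁) (hv : HasShape A x y v₀ v₁) (hdet : signedArea u₀ u₁ = signedArea v₀ v₁) :
    IsRotationOf (pairLattice u₀ u₁) (pairLattice v₀ v₁) := by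
  have hu' := hu.linearIndependent hA hy
  have hv' := hv.linearIndependent hA hy
  let e : Plane ≃ₗ[ℝ] Plane := (pairBasis hv').equiv (pairBasis hu') (Equiv.refl _)
  have he0 : e v₀ = u₀ := by
    have := (pairBasis hv').equiv_apply 0 (pairBasis hu') (Equiv.refl _)
    simpa using this
  have he1 : e v₁ = u₁ := by
    have := (pairBasis hv').equiv_apply 1 (pairBasis hu') (Equiv.refl _)
    simpa using this
  have hnorm : ∀ w, ‖e w‖ = ‖w‖ := by
    intro w
    have hw := (pairBasis hv').sum_repr w
    rw [Fin.sum_univ_two] at hw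
    simp only [coe_pairBasis, Matrix.cons_val_zero, Matrix.cons_val_one] at hw
    rw [← hw, map_add, map_smul, map_smul, he0, he1, ← sq_eq_sq₀ (norm_nonneg _) (norm_nonneg _), hu, hv]
  refine ⟨⟨e, hnorm⟩, ?_, ?_⟩
  · have h1 := (EuclideanSpace.basisFun (Fin 2) ℝ).toBasis.det_comp (e : Plane →ₗ[ℝ] Plane) ![v₀, v₁]
    rw [basisFun_det_eq_signedArea, basisFun_det_eq_signedArea] at h1
    simp [he0, he1, hdet] at h1
    have h2 : signedArea v₀ v₁ ≠ 0 := by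
      intro h0
      have := hv.signedArea_sq hy
      rw [h0] at this
      have : 0 < A ^ 2 := by positivity
      linarith
    exact (mul_eq_right₀ h2).1 h1.symm
  · ext w
    simp only [SetLike.mem_coe, mem_pairLattice, Set.mem_image]
    constructor
    · rintro ⟨m, n, rfl⟩
      refine ⟨_, ⟨m, n, rfl⟩, ?_⟩
      change e _ = _
      rw [map_add, map_smul, map_smul, he0, he1]
    · rintro ⟨_, ⟨m, n, rfl⟩, rfl⟩
      refine ⟨m, n, ?_⟩
      change _ = e _
      rw [map_add, map_smul, map_smul, he0, he1]

lemma HasShape.swap_triangular {A : ℝ} {u₀ u₁ : Plane} (h : HasShape A (1 / 2) (√3 / 2) u₀ u₁) :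
    HasShape A (1 / 2) (√3 / 2) u₁ u₀ := by
  intro m n
  rw [add_comm, h]
  congr 2
  have h33 : √3 ^ 2 = 3 := Real.sq_sqrt (by norm_num)
  rw [div_pow, h33]
  ring

/-- Reflections are not needed: the triangular form is symmetric in its two basis vectors, so
swapping them corrects a wrong orientation. -/
lemma isRotationOf_of_triangular {A : ℝ} {u₀ u₁ v₀ v₁ : Plane} (hA : 0 < A)
    (hu : HasShape A (1 / 2) (√3 / 2) u₀ u₁) (hv : HasShape A (1 / 2) (√3 / 2) v₀ v₁) :
    IsRotationOf (pairLattice u₀ u₁) (pairLattice v₀ v₁) := by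
  have hy : 0 < √3 / 2 := by positivity
  rcases sq_eq_sq_iff_eq_or_eq_neg.1 ((hu.signedArea_sq hy).trans (hv.signedArea_sq hy).symm) with h | h
  · exact exists_rotation hA hy hu hv h
  · rw [pairLattice_comm v₀ v₁]
    exact exists_rotation hA hy hu hv.swap_triangular (h.trans (signedArea_comm _ _).symm)

/-- Among lattices of equal covolume the triangular ones, and only they, minimise the theta
series. -/
theorem latticeTheta_triangular_lt {A τ : ℝ} {v₀ v₁ : Plane} (hA : 0 < A) (hτ : 0 < τ)
    (hv : HasShape A (1 / 2) (√3 / 2) v₀ v₁) {L : Submodule ℤ Plane} (hL : IsBravaisLattice L)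
    (hcov : ZLattice.covolume L = A) (hrot : ¬IsRotationOf L (pairLattice v₀ v₁)) :
    latticeTheta τ (pairLattice v₀ v₁) < latticeTheta τ L := by
  obtain ⟨u₀, u₁, hu, rfl⟩ := hL.exists_pair
  obtain ⟨B, x, y, w₀, w₁, hB, hx, hx2, hy, hxy, hw, hwL⟩ := exists_reduced_hasShape hu
  rw [← hwL] at hcov hrot ⊢
  rw [hw.covolume hB hy] at hcov
  subst hcov
  have hne : ¬(x = 1 / 2 ∧ y = √3 / 2) := by
    rintro ⟨rfl, rfl⟩
    exact hrot (isRotationOf_of_triangular hA hw hv)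
  have h := quadTheta_triangular_lt (show 0 < τ * B / Real.pi by have := Real.pi_pos; positivity)
    hx hx2 hy hxy hne
  have h0 : 0 < quadTheta (τ * B / Real.pi) x y := by
    refine lt_of_le_of_lt ?_ h
    exact tsum_nonneg fun _ => (Real.exp_pos _).le
  have h1 := (ENNReal.ofReal_lt_ofReal_iff h0).2 h
  rw [← hw.one_add_latticeTheta hB hy hτ, ← hv.one_add_latticeTheta hB (by positivity) hτ] at h1
  exact lt_of_add_lt_add_left h1

/-! ### Gaussian mixtures and their convolutions. -/

/-- The Gaussian `exp (-s |w|²)` with values in `[0, ∞]`. -/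
noncomputable def planeGaussian (s : ℝ) (w : Plane) : ℝ≥0∞ := ENNReal.ofReal (Real.exp (-s * ‖w‖ ^ 2))

@[fun_prop]
lemma measurable_planeGaussian_comp {α : Type*} [MeasurableSpace α] {s : α → ℝ} {w : α → Plane}
    (hs : Measurable s) (hw : Measurable w) : Measurable fun z => planeGaussian (s z) (w z) := by
  unfold planeGaussian
  fun_prop

/-- The total mass of a Gaussian. -/
noncomputable def planeGaussianMass (s : ℝ) : ℝ≥0∞ := ∫⁻ u : Plane, planeGaussian s u

@[fun_prop]
lemma measurable_planeGaussianMass : Measurable planeGaussianMass := by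
  unfold planeGaussianMass
  refine Measurable.lintegral_prod_right' (f := fun z : ℝ × Plane => planeGaussian z.1 z.2) ?_
  fun_prop

lemma planeGaussian_pos (s : ℝ) (w : Plane) : 0 < planeGaussian s w :=
  ENNReal.ofReal_pos.2 (Real.exp_pos _)

lemma planeGaussianMass_pos (s : ℝ) : 0 < planeGaussianMass s := by
  rw [planeGaussianMass, lintegral_pos_iff_support (by fun_prop)]
  have : Function.support (fun u : Plane => planeGaussian s u) = univ :=
    Set.eq_univ_of_forall fun u => (planeGaussian_pos s u).ne'
  rw [this]
  exact Measure.measure_univ_pos.2 (NeZero.ne _)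

lemma planeGaussianMass_lt_top {s : ℝ} (hs : 0 < s) : planeGaussianMass s < ∞ := by
  have h : Integrable fun v : Plane => Real.exp (-s * ‖v‖ ^ 2) := by
    have := (GaussianFourier.integrable_cexp_neg_mul_sq_norm_add (V := Plane) (b := s) (by simpa using hs) 0 0).re
    refine this.congr (Filter.Eventually.of_forall fun v => ?_)
    have e : (-(s : ℂ) * (‖v‖ : ℂ) ^ 2 + 0 * ((inner ℝ 0 v : ℝ) : ℂ)) = ((-s * ‖v‖ ^ 2 : ℝ) : ℂ) := by
      push_cast; ring
    change RCLike.re (Complex.exp _) = _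
    rw [e, ← Complex.ofReal_exp]
    rfl
  exact h.lintegral_lt_top

lemma planeGaussian_mul_planeGaussian_sub {s t : ℝ} (hst : 0 < s + t) (u w : Plane) :
    planeGaussian s u * planeGaussian t (u - w) =
      planeGaussian (s + t) (u - (t / (s + t)) • w) * planeGaussian (s * t / (s + t)) w := by
  unfold planeGaussian
  rw [← ENNReal.ofReal_mul (Real.exp_pos _).le, ← ENNReal.ofReal_mul (Real.exp_pos _).le, ← Real.exp_add,
    ← Real.exp_add, norm_sub_sq_real, norm_sub_sq_real, inner_smul_right, norm_smul, mul_pow,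
    Real.norm_eq_abs, sq_abs]
  congr 2
  field_simp
  ring

lemma lintegral_planeGaussian_mul_sub {s t : ℝ} (hst : 0 < s + t) (w : Plane) :
    ∫⁻ u : Plane, planeGaussian s u * planeGaussian t (u - w) =
      planeGaussianMass (s + t) * planeGaussian (s * t / (s + t)) w := by
  simp_rw [planeGaussian_mul_planeGaussian_sub hst]
  rw [lintegral_mul_const _ (by fun_prop),
    lintegral_sub_right_eq_self (fun u => planeGaussian (s + t) u), planeGaussianMass]

lemma planeGaussian_neg (s : ℝ) (w : Plane) : planeGaussian s (-w) = planeGaussian s w := by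
  simp [planeGaussian]

lemma IsLaplaceOfSquaredNorm.nonneg {g : Plane → ℝ} (h : IsLaplaceOfSquaredNorm g) (x : Plane) :
    0 ≤ g x := by
  obtain ⟨m, -, hm⟩ := h
  rw [(hm x).2]
  exact integral_nonneg fun _ => (Real.exp_pos _).le

/-- The value at the origin is the total mass, hence the measure is finite. An atom at `t = 0` would
add a positive constant to `g`, contradicting integrability. -/
lemma IsLaplaceOfSquaredNorm.exists_measure {g : Plane → ℝ} (h : IsLaplaceOfSquaredNorm g)
    (hg : ∫⁻ x, ENNReal.ofReal (g x) ≠ ∞) :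
    ∃ ν : Measure ℝ, IsFiniteMeasure ν ∧ (∀ᵐ t ∂ν, 0 < t) ∧
      ∀ x, ENNReal.ofReal (g x) = ∫⁻ t, planeGaussian t x ∂ν := by
  obtain ⟨m, -, hm⟩ := h
  have hrep : ∀ x, ENNReal.ofReal (g x) = ∫⁻ t, planeGaussian t x ∂(m.restrict (Ici 0)) := by
    intro x
    rw [(hm x).2, ofReal_integral_eq_lintegral_ofReal (hm x).1
      (Filter.Eventually.of_forall fun _ => (Real.exp_pos _).le)]
    refine lintegral_congr fun t => ?_
    rw [planeGaussian, neg_mul, neg_mul, mul_comm]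
  refine ⟨m.restrict (Ici 0), ⟨?_⟩, ?_, hrep⟩
  · have := hrep 0
    simp [planeGaussian] at this
    simp [← this]
  · have h0 : (m.restrict (Ici 0)) {0} = 0 := by
      by_contra hne
      apply hg
      rw [eq_top_iff]
      calc (∞ : ℝ≥0∞) = (m.restrict (Ici 0)) {0} * (volume : Measure Plane) univ := by
            rw [measure_univ_of_isAddLeftInvariant, ENNReal.mul_top hne]
        _ = ∫⁻ _ : Plane, (m.restrict (Ici 0)) {0} := (lintegral_const _).symm
        _ ≤ ∫⁻ x, ENNReal.ofReal (g x) := by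
            refine lintegral_mono fun x => ?_
            rw [hrep x]
            calc (m.restrict (Ici 0)) {0} = ∫⁻ t in {0}, planeGaussian t x ∂(m.restrict (Ici 0)) := by
                  rw [lintegral_singleton]; simp [planeGaussian]
              _ ≤ _ := setLIntegral_le_lintegral _ _
    have h1 : ∀ᵐ t ∂(m.restrict (Ici 0)), t ≠ 0 := by
      rw [ae_iff]
      simpa using h0
    filter_upwards [h1, ae_restrict_mem measurableSet_Ici] with t ht ht2
    exact lt_of_le_of_ne ht2 ht.symm

lemma lintegral_gaussian_mixture {l : Measure ℝ} [SFinite l] {g h : Plane → ℝ≥0∞}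
    (hg : ∀ x, g x = ∫⁻ a, planeGaussian a x ∂l) (hh : Measurable h) :
    ∫⁻ u, h u ∂((volume : Measure Plane).withDensity g) =
      ∫⁻ a, (∫⁻ u : Plane, planeGaussian a u * h u) ∂l := by
  have hgm : Measurable g := by
    have : g = fun x => ∫⁻ a, planeGaussian a x ∂l := funext hg
    rw [this]
    exact Measurable.lintegral_prod_right' (f := fun z : Plane × ℝ => planeGaussian z.2 z.1) (by fun_prop)
  rw [lintegral_withDensity_eq_lintegral_mul _ hgm hh, lintegral_lintegral_swap (by fun_prop)]
  refine lintegral_congr fun u => ?_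
  rw [lintegral_mul_const _ (by fun_prop), Pi.mul_apply, hg]

/-- The exponent of the convolution of Gaussians with exponents `t`, `b` and `a`. -/
noncomputable def convolvedExponent (z : ℝ × ℝ × ℝ) : ℝ :=
  z.2.2 * (z.2.1 * z.1 / (z.2.1 + z.1)) / (z.2.2 + z.2.1 * z.1 / (z.2.1 + z.1))

/-- The constant of the convolution of Gaussians with exponents `t`, `b` and `a`. -/
noncomputable def convolvedMass (z : ℝ × ℝ × ℝ) : ℝ≥0∞ :=
  planeGaussianMass (z.2.1 + z.1) * planeGaussianMass (z.2.2 + z.2.1 * z.1 / (z.2.1 + z.1))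

@[fun_prop]
lemma measurable_convolvedExponent : Measurable convolvedExponent := by
  unfold convolvedExponent
  fun_prop

@[fun_prop]
lemma measurable_convolvedMass : Measurable convolvedMass := by
  unfold convolvedMass
  fun_prop

/-- After Tonelli, integrating out `v` merges the exponents `b, t` into `b t / (b + t)`; integrating
out `u` merges the result with `a`. A Gaussian in `x` remains. -/
lemma lintegral_mixture_sub {l n : Measure ℝ} [SFinite l] [SFinite n] {r F : Plane → ℝ≥0∞}
    (hl : ∀ᵐ t ∂l, 0 < t) (hn : ∀ᵐ t ∂n, 0 < t)
    (hr : ∀ x, r x = ∫⁻ a, planeGaussian a x ∂l) (hF : ∀ x, F x = ∫⁻ t, planeGaussian t x ∂n)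
    [SFinite ((volume : Measure Plane).withDensity r)] (x : Plane) :
    ∫⁻ p : Plane × Plane, F (p.1 - x - p.2)
      ∂(((volume : Measure Plane).withDensity r).prod ((volume : Measure Plane).withDensity r)) =
      ∫⁻ z, convolvedMass z * planeGaussian (convolvedExponent z) x ∂(n.prod (l.prod l)) := by
  set μ := (volume : Measure Plane).withDensity r with hμ
  have hmix : ∀ {h : Plane → ℝ≥0∞}, Measurable h → ∫⁻ u, h u ∂μ =
      ∫⁻ a, (∫⁻ u : Plane, planeGaussian a u * h u) ∂l := fun hh => lintegral_gaussian_mixture hr hh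
  have hFm : Measurable F := by
    rw [show F = fun x => ∫⁻ t, planeGaussian t x ∂n from funext hF]
    exact Measurable.lintegral_prod_right' (f := fun z : Plane × ℝ => planeGaussian z.2 z.1) (by fun_prop)
  rw [lintegral_prod _ (by fun_prop), lintegral_prod _ (by fun_prop)]
  simp_rw [hF]
  have s1 : ∀ u : Plane, ∫⁻ v, ∫⁻ t, planeGaussian t (u - x - v) ∂n ∂μ =
      ∫⁻ t, ∫⁻ v, planeGaussian t (u - x - v) ∂μ ∂n := fun u =>
    lintegral_lintegral_swap (by unfold Function.uncurry; fun_prop)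
  simp_rw [s1]
  have m1 : Measurable fun q : Plane × ℝ => ∫⁻ v, planeGaussian q.2 (q.1 - x - v) ∂μ :=
    Measurable.lintegral_prod_right' (f := fun z : (Plane × ℝ) × Plane =>
      planeGaussian z.1.2 (z.1.1 - x - z.2)) (by fun_prop)
  rw [lintegral_lintegral_swap m1.aemeasurable]
  refine lintegral_congr_ae ?_
  filter_upwards [hn] with t ht
  have s2 : ∀ u : Plane, ∫⁻ v, planeGaussian t (u - x - v) ∂μ =
      ∫⁻ b, planeGaussianMass (b + t) * planeGaussian (b * t / (b + t)) (u - x) ∂l := by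
    intro u
    rw [hmix (by fun_prop)]
    refine lintegral_congr_ae ?_
    filter_upwards [hl] with b hb
    rw [← lintegral_planeGaussian_mul_sub (by linarith)]
    refine lintegral_congr fun v => ?_
    rw [← planeGaussian_neg t, neg_sub]
  simp_rw [s2]
  rw [lintegral_lintegral_swap (by unfold Function.uncurry; fun_prop), lintegral_prod _ (by fun_prop)]
  refine lintegral_congr_ae ?_
  filter_upwards [hl] with b hb
  rw [lintegral_const_mul _ (by fun_prop), hmix (by fun_prop), ← lintegral_const_mul _ ?_]
  · refine lintegral_congr_ae ?_
    filter_upwards [hl] with a ha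
    have : 0 < b * t / (b + t) := by positivity
    rw [lintegral_planeGaussian_mul_sub (by linarith), ← mul_assoc]
    rfl
  · exact Measurable.lintegral_prod_right' (f := fun z : ℝ × Plane =>
      planeGaussian z.1 z.2 * planeGaussian (b * t / (b + t)) (z.2 - x)) (by fun_prop)

/-! ### Finiteness of the energy and its expression through theta series. -/

lemma countable_pairLattice (u₀ u₁ : Plane) : Countable (pairLattice u₀ u₁) := by
  have : (pairLattice u₀ u₁ : Set Plane) ⊆ range fun p : ℤ × ℤ => (p.1 : ℝ) • u₀ + (p.2 : ℝ) • u₁ := by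
    intro x hx
    obtain ⟨m, n, h⟩ := mem_pairLattice.1 hx
    exact ⟨(m, n), h⟩
  exact ((countable_range _).mono this).to_subtype

lemma IsBravaisLattice.countable_nonzero {L : Submodule ℤ Plane} (hL : IsBravaisLattice L) :
    Countable {x : Plane // x ∈ L ∧ x ≠ 0} := by
  obtain ⟨u₀, u₁, -, rfl⟩ := hL.exists_pair
  have := countable_pairLattice u₀ u₁
  exact Function.Injective.countable
    (f := fun x : {x : Plane // x ∈ pairLattice u₀ u₁ ∧ x ≠ 0} => (⟨x.1, x.2.1⟩ : pairLattice u₀ u₁))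
    fun x y h => Subtype.ext (congrArg (fun z : pairLattice u₀ u₁ => (z : Plane)) h)

lemma measurable_latticeTheta {L : Submodule ℤ Plane} (hL : IsBravaisLattice L) :
    Measurable fun τ => latticeTheta τ L := by
  have := hL.countable_nonzero
  exact Measurable.tsum fun x => by fun_prop

/-- A periodic sum of a decaying function is bounded. -/
lemma exists_bound_tsum_lattice {L : Submodule ℤ Plane} (hL : IsBravaisLattice L) {C r : ℝ}
    (hC : 0 < C) (hr : 2 < r) :
    ∃ K : ℝ≥0∞, K ≠ ∞ ∧ ∀ w : Plane, ∑' x : L, ENNReal.ofReal (C / (1 + ‖w - x‖) ^ r) ≤ K := by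
  obtain ⟨u₀, u₁, hu, rfl⟩ := hL.exists_pair
  rw [pairLattice_eq_span_pairBasis hu]
  set b := pairBasis hu
  set M := Submodule.span ℤ (range b)
  set R := ∑ i, ‖b i‖ with hR
  have hR0 : 0 ≤ R := Finset.sum_nonneg fun _ _ => norm_nonneg _
  have hfin : Module.finrank ℤ M = 2 := by
    rw [ZLattice.rank ℝ M]; simp
  have hsum := ZLattice.summable_norm_rpow M (-r) (by rw [hfin]; push_cast; linarith)
  -- The real power `0 ^ (-r)` is `0`, so the origin needs a term of its own.
  have hs2 : Summable fun z : M => C * (1 + R) ^ r * ((if z = 0 then 1 else 0) + ‖z‖ ^ (-r)) :=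
    (((hasSum_ite_eq (0 : M) (1 : ℝ)).summable).add hsum).mul_left _
  refine ⟨∑' z : M, ENNReal.ofReal (C * (1 + R) ^ r * ((if z = 0 then 1 else 0) + ‖z‖ ^ (-r))),
    hs2.tsum_ofReal_ne_top, fun w => ?_⟩
  -- Translating by a lattice vector moves `w` into the fundamental parallelogram, which makes the
  -- bound uniform.
  have e := (Equiv.addRight (ZSpan.floor b w)).tsum_eq
    (fun x : M => ENNReal.ofReal (C / (1 + ‖w - x‖) ^ r))
  rw [← e]
  refine ENNReal.tsum_le_tsum fun z => ENNReal.ofReal_le_ofReal ?_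
  have h1 : w - ((Equiv.addRight (ZSpan.floor b w)) z : M) = ZSpan.fract b w - z := by
    rw [ZSpan.fract_apply]
    simp
    abel
  rw [h1]
  have h2 : ‖ZSpan.fract b w‖ ≤ R := ZSpan.norm_fract_le b w
  have h3 : 1 + ‖(z : Plane)‖ ≤ (1 + R) * (1 + ‖ZSpan.fract b w - z‖) := by
    have := norm_sub_norm_le (z : Plane) (ZSpan.fract b w)
    rw [norm_sub_rev] at this
    nlinarith [norm_nonneg (ZSpan.fract b w - z), mul_nonneg hR0 (norm_nonneg (ZSpan.fract b w - z))]
  have h4 : (1 + ‖(z : Plane)‖) ^ r ≤ (1 + R) ^ r * (1 + ‖ZSpan.fract b w - z‖) ^ r := by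
    rw [← Real.mul_rpow (by positivity) (by positivity)]
    exact Real.rpow_le_rpow (by positivity) h3 (by linarith)
  have h5 : ((1 + ‖(z : Plane)‖) ^ r)⁻¹ ≤ (if z = 0 then 1 else 0) + ‖z‖ ^ (-r) := by
    split_ifs with hz
    · have h6 : (1 : ℝ) ≤ (1 + ‖(z : Plane)‖) ^ r :=
        Real.one_le_rpow (by linarith [norm_nonneg (z : Plane)]) (by linarith)
      have : 0 ≤ ‖z‖ ^ (-r) := by positivity
      linarith [inv_le_one_of_one_le₀ h6]
    · rw [zero_add, Real.rpow_neg (norm_nonneg _)]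
      have hz' : 0 < ‖z‖ := norm_pos_iff.2 hz
      refine inv_anti₀ (Real.rpow_pos_of_pos hz' r) ?_
      exact Real.rpow_le_rpow hz'.le (by rw [Submodule.coe_norm]; linarith) (by linarith)
  calc C / (1 + ‖ZSpan.fract b w - z‖) ^ r ≤ C * (1 + R) ^ r * ((1 + ‖(z : Plane)‖) ^ r)⁻¹ := by
        rw [div_le_iff₀ (by positivity), mul_assoc, mul_assoc]
        refine le_mul_of_one_le_right hC.le ?_
        rw [mul_left_comm, ← div_eq_inv_mul, one_le_div (by positivity)]
        exact h4
    _ ≤ _ := mul_le_mul_of_nonneg_left h5 (by positivity)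

lemma IsPotential.exists_decay {f : Plane → ℝ} (hf : IsPotential f) :
    ∃ C > (0 : ℝ), ∃ r > (2 : ℝ), ∀ x, f x ≤ C / (1 + ‖x‖) ^ r := by
  obtain ⟨C, hC, η, hη, h⟩ := hf.decay
  refine ⟨C, hC, 2 + η, by linarith, fun x => ?_⟩
  linarith [h x, le_abs_self (f x), norm_nonneg (𝓕 (fun y : Plane => (f y : ℂ)) x)]

lemma IsPotential.lintegral_ne_top {f : Plane → ℝ} (hf : IsPotential f) :
    ∫⁻ x, ENNReal.ofReal (f x) ≠ ∞ := by
  obtain ⟨C, hC, r, hr, h⟩ := hf.exists_decay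
  have hint : Integrable fun x : Plane => C * (1 + ‖x‖) ^ (-r) :=
    (integrable_one_add_norm (by simpa using hr)).const_mul C
  refine ne_top_of_le_ne_top hint.lintegral_lt_top.ne (lintegral_mono fun x => ENNReal.ofReal_le_ofReal ?_)
  rw [Real.rpow_neg (by positivity), ← div_eq_mul_inv]
  exact h x

lemma IsPotential.measurable {f : Plane → ℝ} (hf : IsPotential f) :
    Measurable fun x => ENNReal.ofReal (f x) := by
  obtain ⟨n, _, -, hn⟩ := hf.laplace.exists_measure hf.lintegral_ne_top
  rw [show (fun x => ENNReal.ofReal (f x)) = fun x => ∫⁻ t, planeGaussian t x ∂n from funext hn]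
  exact Measurable.lintegral_prod_right' (f := fun z : Plane × ℝ => planeGaussian z.2 z.1) (by fun_prop)

/-- Needed for uniqueness: a strict inequality between integrands is lost if both integrals are
infinite. The sum over the lattice is bounded uniformly in `u - v`, and `μ` has mass one. -/
lemma latticeEnergy_ne_top {f : Plane → ℝ} (hf : IsPotential f) (μ : Measure Plane)
    [IsProbabilityMeasure μ] {L : Submodule ℤ Plane} (hL : IsBravaisLattice L) :
    latticeEnergy f μ L ≠ ∞ := by
  obtain ⟨C, hC, r, hr, h⟩ := hf.exists_decay
  obtain ⟨K, hK, hb⟩ := exists_bound_tsum_lattice hL hC hr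
  have := hL.countable_nonzero
  have hm := hf.measurable
  unfold latticeEnergy
  have hmx : ∀ x : {x : Plane // x ∈ L ∧ x ≠ 0}, AEMeasurable
      (fun p : Plane × Plane => ENNReal.ofReal (f (p.1 - (x : Plane) - p.2))) (μ.prod μ) := fun x =>
    (hm.comp (g := fun x => ENNReal.ofReal (f x)) (f := fun p : Plane × Plane => p.1 - (x : Plane) - p.2)
      (by fun_prop)).aemeasurable
  rw [← lintegral_tsum hmx]
  refine ne_top_of_le_ne_top hK ?_
  calc _ ≤ ∫⁻ _ : Plane × Plane, K ∂(μ.prod μ) := by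
        refine lintegral_mono fun p => ?_
        refine le_trans ?_ (hb (p.1 - p.2))
        refine le_trans (ENNReal.tsum_le_tsum fun x => ENNReal.ofReal_le_ofReal (h _)) ?_
        have hinj : Function.Injective
            fun x : {x : Plane // x ∈ L ∧ x ≠ 0} => (⟨x.1, x.2.1⟩ : L) :=
          fun x y h => Subtype.ext (congrArg (fun z : L => (z : Plane)) h)
        refine le_trans (le_of_eq (tsum_congr fun x => ?_)) (ENNReal.tsum_comp_le_tsum_of_injective hinj
          fun x : L => ENNReal.ofReal (C / (1 + ‖p.1 - p.2 - x‖) ^ r))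
        simp only
        rw [sub_right_comm]
    _ = K := by simp

lemma latticeEnergy_eq_lintegral_latticeTheta {f ρ : Plane → ℝ} {l n : Measure ℝ} [SFinite l] [SFinite n]
    (hl : ∀ᵐ t ∂l, 0 < t) (hn : ∀ᵐ t ∂n, 0 < t)
    (hr : ∀ x, ENNReal.ofReal (ρ x) = ∫⁻ a, planeGaussian a x ∂l)
    (hF : ∀ x, ENNReal.ofReal (f x) = ∫⁻ t, planeGaussian t x ∂n)
    (μ : Measure Plane) [SFinite μ]
    (hμ : μ = (volume : Measure Plane).withDensity (fun x => ENNReal.ofReal (ρ x)))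
    {L : Submodule ℤ Plane} (hL : IsBravaisLattice L) :
    latticeEnergy f μ L =
      ∫⁻ z, convolvedMass z * latticeTheta (convolvedExponent z) L ∂(n.prod (l.prod l)) := by
  subst hμ
  have := hL.countable_nonzero
  unfold latticeEnergy latticeTheta
  simp_rw [← ENNReal.tsum_mul_left]
  rw [lintegral_tsum fun x => by
    change AEMeasurable (fun z => convolvedMass z * planeGaussian (convolvedExponent z) x) _
    fun_prop]
  exact tsum_congr fun x => lintegral_mixture_sub hl hn hr hF x

lemma ae_pos_of_prod {l n : Measure ℝ} [SFinite l] [SFinite n] (hl : ∀ᵐ t ∂l, 0 < t)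
    (hn : ∀ᵐ t ∂n, 0 < t) :
    ∀ᵐ z : ℝ × ℝ × ℝ ∂(n.prod (l.prod l)), 0 < z.1 ∧ 0 < z.2.1 ∧ 0 < z.2.2 := by
  have h1 := (Measure.quasiMeasurePreserving_fst (μ := n) (ν := l.prod l)).ae hn
  have h2 := (Measure.quasiMeasurePreserving_snd (μ := n) (ν := l.prod l)).ae
    ((Measure.quasiMeasurePreserving_fst (μ := l) (ν := l)).ae hl)
  have h3 := (Measure.quasiMeasurePreserving_snd (μ := n) (ν := l.prod l)).ae
    ((Measure.quasiMeasurePreserving_snd (μ := l) (ν := l)).ae hl)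
  filter_upwards [h1, h2, h3] with z a b c using ⟨a, b, c⟩

lemma convolvedExponent_pos {z : ℝ × ℝ × ℝ} (h : 0 < z.1 ∧ 0 < z.2.1 ∧ 0 < z.2.2) :
    0 < convolvedExponent z := by
  obtain ⟨h1, h2, h3⟩ := h
  unfold convolvedExponent
  positivity

lemma convolvedMass_ne_zero (z : ℝ × ℝ × ℝ) : convolvedMass z ≠ 0 :=
  mul_ne_zero (planeGaussianMass_pos _).ne' (planeGaussianMass_pos _).ne'

lemma convolvedMass_ne_top {z : ℝ × ℝ × ℝ} (h : 0 < z.1 ∧ 0 < z.2.1 ∧ 0 < z.2.2) :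
    convolvedMass z ≠ ∞ := by
  obtain ⟨h1, h2, h3⟩ := h
  refine ENNReal.mul_ne_top (planeGaussianMass_lt_top (by positivity)).ne
    (planeGaussianMass_lt_top (by positivity)).ne

lemma smul_pairLattice (c : ℝ) (u₀ u₁ : Plane) :
    c • pairLattice u₀ u₁ = pairLattice (c • u₀) (c • u₁) := by
  ext x
  simp only [Submodule.mem_smul_pointwise_iff_exists, mem_pairLattice]
  constructor
  · rintro ⟨_, ⟨m, n, rfl⟩, rfl⟩
    exact ⟨m, n, by module⟩
  · rintro ⟨m, n, rfl⟩
    exact ⟨_, ⟨m, n, rfl⟩, by module⟩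

lemma hasShape_triangularLattice {δ : ℝ} (hδ : 0 < δ) :
    HasShape δ⁻¹ (1 / 2) (√3 / 2) ((√δ)⁻¹ • (√(2 / √3) • (!₂[1, 0] : Plane)))
      ((√δ)⁻¹ • (√(2 / √3) • (!₂[1 / 2, √3 / 2] : Plane))) := by
  intro m n
  have h33 : √3 ^ 2 = 3 := Real.sq_sqrt (by norm_num)
  have hd : √δ ^ 2 = δ := Real.sq_sqrt hδ.le
  have h2 : √(2 / √3) ^ 2 = 2 / √3 := Real.sq_sqrt (by positivity)
  have e : m • ((√δ)⁻¹ • (√(2 / √3) • (!₂[1, 0] : Plane))) +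
      n • ((√δ)⁻¹ • (√(2 / √3) • (!₂[1 / 2, √3 / 2] : Plane))) =
      ((√δ)⁻¹ * √(2 / √3)) • (!₂[m + n / 2, n * (√3 / 2)] : Plane) := by
    ext i
    fin_cases i <;> simp <;> ring
  rw [e, norm_smul, mul_pow, EuclideanSpace.norm_sq_eq, Fin.sum_univ_two, Real.norm_eq_abs, sq_abs,
    mul_pow, inv_pow, hd, h2]
  simp only [Real.norm_eq_abs, sq_abs, Matrix.cons_val_zero, Matrix.cons_val_one]
  field_simp

lemma smul_triangularLattice (c : ℝ) :
    c • triangularLattice = pairLattice (c • (√(2 / √3) • (!₂[1, 0] : Plane)))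
      (c • (√(2 / √3) • (!₂[1 / 2, √3 / 2] : Plane))) := by
  rw [← smul_pairLattice, pairLattice, ← range_pair]
  rfl

theorem theorem2 (f : Plane → ℝ) (hf : IsPotential f) (hf0 : f ≠ 0)
    (μ : Measure Plane) [IsProbabilityMeasure μ]
    (ρ : Plane → ℝ) (hρ : IsLaplaceOfSquaredNorm ρ)
    (hμ : μ = (volume : Measure Plane).withDensity (fun x => ENNReal.ofReal (ρ x)))
    (δ : ℝ) (hδ : 0 < δ) :
    IsUniqueMinimizerUpToRotation (latticeEnergy f μ) δ ((√δ)⁻¹ • triangularLattice) := by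
  have hshape := hasShape_triangularLattice hδ
  rw [smul_triangularLattice]
  generalize (√δ)⁻¹ • (√(2 / √3) • (!₂[1, 0] : Plane)) = v₀ at *
  generalize (√δ)⁻¹ • (√(2 / √3) • (!₂[1 / 2, √3 / 2] : Plane)) = v₁ at *
  have hA : 0 < δ⁻¹ := inv_pos.2 hδ
  have h3 : 0 < √3 / 2 := by positivity
  have hM := isBravaisLattice_pairLattice (hshape.linearIndependent hA h3)
  refine ⟨⟨hM, by rw [latticeDensity, hshape.covolume hA h3, inv_inv]⟩, fun L hL hLδ => ?_⟩
  have hcov : ZLattice.covolume L = δ⁻¹ := by rw [← hLδ, latticeDensity, inv_inv]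
  have hμ1 : ∫⁻ x, ENNReal.ofReal (ρ x) = 1 := by
    have h := measure_univ (μ := μ)
    rwa [hμ, withDensity_apply _ MeasurableSet.univ, Measure.restrict_univ] at h
  obtain ⟨n, _, hn, hfn⟩ := hf.laplace.exists_measure hf.lintegral_ne_top
  obtain ⟨l, _, hl, hρl⟩ := hρ.exists_measure (by rw [hμ1]; exact ENNReal.one_ne_top)
  have hE : ∀ {N : Submodule ℤ Plane}, IsBravaisLattice N → latticeEnergy f μ N =
      ∫⁻ z, convolvedMass z * latticeTheta (convolvedExponent z) N ∂(n.prod (l.prod l)) := fun hN =>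
    latticeEnergy_eq_lintegral_latticeTheta hl hn hρl hfn μ hμ hN
  have hn0 : n ≠ 0 := by
    rintro rfl
    refine hf0 (funext fun x => le_antisymm ?_ (hf.laplace.nonneg x))
    have := hfn x
    rwa [lintegral_zero_measure, ENNReal.ofReal_eq_zero] at this
  have hl0 : l ≠ 0 := by
    rintro rfl
    simp [hρl] at hμ1
  have hP0 : n.prod (l.prod l) ≠ 0 := by
    rw [← Measure.measure_univ_ne_zero] at hn0 hl0 ⊢
    rw [← univ_prod_univ, Measure.prod_prod, ← univ_prod_univ, Measure.prod_prod]
    exact mul_ne_zero hn0 (mul_ne_zero hl0 hl0)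
  by_cases hrot : IsRotationOf L (pairLattice v₀ v₁)
  · have heq : latticeEnergy f μ L = latticeEnergy f μ (pairLattice v₀ v₁) := by
      rw [hE hL, hE hM]
      simp_rw [latticeTheta_eq_of_isRotationOf hrot]
    exact ⟨heq.ge, fun _ => hrot, fun _ => heq⟩
  · have hlt : latticeEnergy f μ (pairLattice v₀ v₁) < latticeEnergy f μ L := by
      have hfin := latticeEnergy_ne_top hf μ hM
      rw [hE hM] at hfin
      rw [hE hL, hE hM]
      -- The theta series are strictly ordered at almost every exponent triple, and the weight is
      -- neither `0` nor `∞` there.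
      refine lintegral_strict_mono hP0 ?_ hfin ?_
      · have := (measurable_latticeTheta hL).comp measurable_convolvedExponent
        exact (measurable_convolvedMass.mul this).aemeasurable
      · filter_upwards [ae_pos_of_prod hl hn] with z hz
        exact (ENNReal.mul_lt_mul_iff_right (convolvedMass_ne_zero z) (convolvedMass_ne_top hz)).2
          (latticeTheta_triangular_lt hA (convolvedExponent_pos hz) hshape hL hcov hrot)
    exact ⟨hlt.le, fun h => absurd h hlt.ne', fun h => absurd h hrot⟩
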